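/- Let $n\ge 1$. Cubes in $\mathbb R^n$ have sides parallel to the axes and $|Q|$ is the volume of $Q$. For $1<r<\infty$, a weight $w$ on $\mathbb R^n$ (a nonnegative locally integrable function, positive almost everywhere) is in $A_r^{loc}$ if $$\sup_{|Q|\le 1}\frac1{|Q|^r}\int_Q w\,dx\Big(\int_Q w^{-r'/r}dx\Big)^{r/r'}<\infty,\qquad \tfrac1r+\tfrac1{r'}=1,$$ and it is in $A_1^{loc}$ if $\sup_{|Q|\le1}|Q|^{-1}\int_Qw\,dx\;\mathrm{ess\,sup}_Q\,w^{-1}<\infty$. Put $A_\infty^{loc}=\bigcup_{1\le r<\infty}A_r^{loc}$ and, for $w\in A_\infty^{loc}$, $q_w=\inf\{r\in[1,\infty):w\in A_r^{loc}\}$. Write $w(E)=\int_E w\,dx$, $\|f\|_{L^r_w}=(\int_{\mathbb R^n}|f|^rw\,dx)^{1/r}$ for $0<r<\infty$, and $L^\infty_w=L^\infty$. For $N\in\mathbb N_0$ and a distribution $f\in\mathcal D'(\mathbb R^n)$ let $$\mathcal M_N^0f(x)=\sup\Big\{|\varphi_t*f(x)|:0<t<1,\ \varphi\in C_c^\infty(\mathbb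 R^n),\ \mathrm{supp}\,\varphi\subset B(0,1),\ \int\varphi\ne0,\ \|D^\alpha\varphi\|_\infty\le1\text{ for }|\alpha|\le N+1\Big\},$$ where $\varphi_t(x)=t^{-n}\varphi(x/t)$. For $p\in(0,1]$ let $h^p_{w,N}$ be the set of $f\in\mathcal D'(\mathbb R^n)$ with $\mathcal M_N^0f\in L^p_w$, let $\|f\|_{h^p_{w,N}}=\|\mathcal M_N^0f\|_{L^p_w}$, and put $N_{p,w}=\max\{0,\lfloor n(q_w/p-1)\rfloor\}+2$. A triplet $(p,q,s)_w$ is admissible if $p\in(0,1]$, $q\in(q_w,\infty]$ and $s$ is a nonnegative integer with $s\ge\lfloor n(q_w/p-1)\rfloor$. A measurable function $a:\mathbb R^n\to\mathbb C$ is a $(p,q,s)_w$-atom if there is a cube $Q$ with $\mathrm{supp}\,a\subset Q$, $\|a\|_{L^q_w}\le w(Q)^{1/q-1/p}$ and, if $|Q|<1$, $\int a(x)x^\alpha dx=0$ for all multi-indices $|\alpha|\le s$. It is a $(p,q)_w$ single atom if $\|a\|_{L^q_w}\le w(\mathbb R^n)^{1/q-1/p}$ (the right-hand side being $0$ if $w(\mathbb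 R^n)=\infty$). The space $h^{p,q,s}_w$ is the set of all $f\in\mathcal D'(\mathbb R^n)$ with $f=\sum_{i=0}^\infty\lambda_ia_i$ in $\mathcal D'(\mathbb R^n)$, where $\lambda_i\in\mathbb C$, $\sum_i|\lambda_i|^p<\infty$, $a_0$ is a $(p,q)_w$ single atom and $a_i$, $i\ge1$, are $(p,q,s)_w$-atoms; $\|f\|_{h^{p,q,s}_w}$ is the infimum of $(\sum_i|\lambda_i|^p)^{1/p}$ over all such decompositions. **Theorem.** Let $w\in A_\infty^{loc}$, let $(p,q,s)_w$ be an admissible triplet and let $N\ge N_{p,w}$ be an integer. Then $$h^{p,q,s}_w\subset h^p_{w,N_{p,w}}\subset h^p_{w,N},$$ and there is a constant $C>0$ such that for all $f\in h^{p,q,s}_w$ $$\|f\|_{h^p_{w,N}}\le\|f\|_{h^p_{w,N_{p,w}}}\le C\,\|f\|_{h^{p,q,s}_w}.$$ -/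

import Mathlib

open MeasureTheory Filter Topology
open scoped ENNReal Distributions

namespace LocalHardy

noncomputable section

/-- Euclidean space `ℝⁿ`. -/
abbrev E (n : ℕ) : Type := EuclideanSpace ℝ (Fin n)

/-- The cube `Q(x, t)` with centre `x`, side length `t` and sides parallel to the axes. -/
def cube {n : ℕ} (x : E n) (t : ℝ) : Set (E n) := {y | ∀ i, |y i - x i| ≤ t / 2}

/-- The measure `w dx`. -/
def wMeasure {n : ℕ} (w : E n → ℝ) : Measure (E n) :=
  volume.withDensity fun x => ENNReal.ofReal (w x)

/-- A weight: a nonnegative locally integrable function that is positive almost everywhere. -/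
structure IsWeight {n : ℕ} (w : E n → ℝ) : Prop where
  nonneg : ∀ x, 0 ≤ w x
  pos_ae : ∀ᵐ x, 0 < w x
  locallyIntegrable : LocallyIntegrable w

/-- The constant `A_p^loc(w)` for `1 < p < ∞`: the supremum over all cubes with `|Q| ≤ 1` of
`|Q|⁻ᵖ (∫_Q w) (∫_Q w^{-p'/p})^{p/p'}`, where `p'/p = 1/(p-1)`. -/
def apConst {n : ℕ} (p : ℝ) (w : E n → ℝ) : ℝ≥0∞ :=
  ⨆ (x : E n) (t : ℝ) (_ : 0 < t) (_ : volume (cube x t) ≤ 1),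
    (volume (cube x t)) ^ (-p) * (∫⁻ y in cube x t, ENNReal.ofReal (w y)) *
      (∫⁻ y in cube x t, ENNReal.ofReal (w y) ^ (-(1 / (p - 1)))) ^ (p - 1)

/-- The constant `A_1^loc(w)`: the supremum over all cubes with `|Q| ≤ 1` of
`|Q|⁻¹ (∫_Q w) (ess sup_Q w⁻¹)`. -/
def a1Const {n : ℕ} (w : E n → ℝ) : ℝ≥0∞ :=
  ⨆ (x : E n) (t : ℝ) (_ : 0 < t) (_ : volume (cube x t) ≤ 1),
    (volume (cube x t))⁻¹ * (∫⁻ y in cube x t, ENNReal.ofReal (w y)) *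
      essSup (fun y => (ENNReal.ofReal (w y))⁻¹) (volume.restrict (cube x t))

/-- The class `A_p^loc`, `1 ≤ p < ∞`. -/
def ApLoc {n : ℕ} (p : ℝ) (w : E n → ℝ) : Prop :=
  IsWeight w ∧ ((p = 1 ∧ a1Const w < ∞) ∨ (1 < p ∧ apConst p w < ∞))

/-- The class `A_∞^loc`, the union of the classes `A_p^loc` over `1 ≤ p < ∞`. -/
def AInftyLoc {n : ℕ} (w : E n → ℝ) : Prop := ∃ p : ℝ, 1 ≤ p ∧ ApLoc p w

/-- The critical index `q_w = inf {p ∈ [1, ∞) : w ∈ A_p^loc}`. -/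
def critIndex {n : ℕ} (w : E n → ℝ) : ℝ := sInf {p : ℝ | 1 ≤ p ∧ ApLoc p w}

/-- `N_{p,w} = max {0, ⌊n (q_w / p - 1)⌋} + 2`. -/
def Npw {n : ℕ} (p : ℝ) (w : E n → ℝ) : ℕ :=
  (max 0 ⌊(n : ℝ) * (critIndex w / p - 1)⌋).toNat + 2

/-- Complex-valued test functions on `ℝⁿ`. -/
abbrev Test (n : ℕ) : Type := 𝓓((⊤ : TopologicalSpace.Opens (E n)), ℂ)

/-- Distributions on `ℝⁿ`: the continuous `ℂ`-linear functionals on the test functions. -/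
abbrev Dist (n : ℕ) : Type := Test n →L[ℂ] ℂ

/-- The test function `y ↦ φ_t (x - y) = t⁻ⁿ φ ((x - y) / t)`, for `t > 0`. -/
def dilate {n : ℕ} (φ : Test n) (t : ℝ) (ht : 0 < t) (x : E n) : Test n where
  toFun y := ((t ^ n)⁻¹ : ℝ) • φ (t⁻¹ • (x - y))
  contDiff' := by
    have h := φ.contDiff
    fun_prop
  hasCompactSupport' := by
    have h := φ.hasCompactSupport
    have h2 : HasCompactSupport fun y : E n => φ (t⁻¹ • (x - y)) :=
      h.comp_homeomorph
        ((Homeomorph.subLeft x).trans (Homeomorph.smulOfNeZero t⁻¹ (inv_ne_zero ht.ne')))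
    exact h2.smul_left (f := fun _ => (((t ^ n)⁻¹ : ℝ)))
  tsupport_subset' := fun _ _ => trivial

/-- The convolution `(φ_t * f)(x)` of a distribution `f` with `φ_t`. -/
def conv {n : ℕ} (f : Dist n) (φ : Test n) (t : ℝ) (ht : 0 < t) (x : E n) : ℂ :=
  f (dilate φ t ht x)

/-- The class `𝓓⁰_N`: test functions `φ` supported in the unit ball, with nonzero integral and
`‖D^α φ‖_∞ ≤ 1` for `|α| ≤ N + 1`. The partial derivatives of order `k` are the values
of the `k`-th derivative on `k`-tuples of standard basis vectors. -/
def testClass {n : ℕ} (N : ℕ) : Set (Test n) :=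
  {φ | tsupport (φ : E n → ℂ) ⊆ Metric.ball 0 1 ∧ ∫ x, φ x ≠ 0 ∧
    ∀ k ≤ N + 1, ∀ j : Fin k → Fin n, ∀ x : E n,
      ‖iteratedFDeriv ℝ k (φ : E n → ℂ) x (fun i => EuclideanSpace.single (j i) (1 : ℝ))‖ ≤ 1}

/-- The local grand maximal function `𝓜⁰_N f`. -/
def grandMax {n : ℕ} (N : ℕ) (f : Dist n) (x : E n) : ℝ≥0∞ :=
  ⨆ (t : ℝ) (ht : 0 < t) (_ : t < 1) (φ ∈ testClass (n := n) N), ‖conv f φ t ht x‖ₑ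

/-- `‖f‖_{h^p_{w,N}} = ‖𝓜⁰_N f‖_{L^p_w}`. -/
def hardyNorm {n : ℕ} (p : ℝ) (w : E n → ℝ) (N : ℕ) (f : Dist n) : ℝ≥0∞ :=
  (∫⁻ x, (grandMax N f x) ^ p ∂(wMeasure w)) ^ (1 / p)

/-- The weighted local Hardy space `h^p_{w,N}`. -/
def hardySpace {n : ℕ} (p : ℝ) (w : E n → ℝ) (N : ℕ) : Set (Dist n) :=
  {f | AEMeasurable (grandMax N f) ∧ hardyNorm p w N f < ∞}

/-- The triplet `(p, q, s)_w` is admissible. -/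
structure Admissible {n : ℕ} (w : E n → ℝ) (p : ℝ) (q : ℝ≥0∞) (s : ℕ) : Prop where
  p_pos : 0 < p
  p_le_one : p ≤ 1
  crit_lt : ENNReal.ofReal (critIndex w) < q
  floor_le : ⌊(n : ℝ) * (critIndex w / p - 1)⌋ ≤ (s : ℤ)

/-- `a` is a `(p, q, s)_w`-atom. For `q = ∞`, the norm of `L^∞_w` is that of `L^∞`, because `w dx`
and `dx` have the same null sets. -/
def IsAtom {n : ℕ} (w : E n → ℝ) (p : ℝ) (q : ℝ≥0∞) (s : ℕ) (a : E n → ℂ) : Prop :=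
  AEStronglyMeasurable a ∧ ∃ (x₀ : E n) (r : ℝ), 0 < r ∧
    (∀ᵐ x, x ∉ cube x₀ r → a x = 0) ∧
    eLpNorm a q (wMeasure w) ≤ (wMeasure w (cube x₀ r)) ^ (q⁻¹.toReal - 1 / p) ∧
    (volume (cube x₀ r) < 1 → ∀ α : Fin n → ℕ, ∑ i, α i ≤ s →
      ∫ x, a x * ((∏ i, x i ^ α i : ℝ) : ℂ) = 0)

/-- `a` is a `(p, q)_w` single atom; the right-hand side is `0` if `w(ℝⁿ) = ∞`. -/
def IsSingleAtom {n : ℕ} (w : E n → ℝ) (p : ℝ) (q : ℝ≥0∞) (a : E n → ℂ) : Prop :=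
  AEStronglyMeasurable a ∧
    eLpNorm a q (wMeasure w) ≤ (wMeasure w Set.univ) ^ (q⁻¹.toReal - 1 / p)

/-- `f = ∑ λᵢ aᵢ` in the sense of distributions, where `a₀` is a single atom, the other `aᵢ` are
atoms and `∑ |λᵢ|ᵖ < ∞`. -/
structure IsAtomicDecomp {n : ℕ} (w : E n → ℝ) (p : ℝ) (q : ℝ≥0∞) (s : ℕ) (f : Dist n)
    (c : ℕ → ℂ) (a : ℕ → E n → ℂ) : Prop where
  summable : Summable fun i => ‖c i‖ ^ p
  single : IsSingleAtom w p q (a 0)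
  atom : ∀ i, 1 ≤ i → IsAtom w p q s (a i)
  tendsto : ∀ ψ : Test n,
    Tendsto (fun k => ∑ i ∈ Finset.range k, c i * ∫ x, a i x * ψ x) atTop (𝓝 (f ψ))

/-- The weighted atomic local Hardy space `h^{p,q,s}_w`. -/
def atomicSpace {n : ℕ} (w : E n → ℝ) (p : ℝ) (q : ℝ≥0∞) (s : ℕ) : Set (Dist n) :=
  {f | ∃ c a, IsAtomicDecomp w p q s f c a}

/-- The quasi-norm of `h^{p,q,s}_w`. -/
def atomicNorm {n : ℕ} (w : E n → ℝ) (p : ℝ) (q : ℝ≥0∞) (s : ℕ) (f : Dist n) : ℝ≥0∞ :=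
  ⨅ (c : ℕ → ℂ) (a : ℕ → E n → ℂ) (_ : IsAtomicDecomp w p q s f c a),
    (∑' i, ‖c i‖ₑ ^ p) ^ (1 / p)

end

end LocalHardy

/-! Enlarging `N` shrinks the class of test functions, which gives the second inclusion and the
first norm inequality. For the rest, the grand maximal function of `∑ cᵢ aᵢ` is at most `∑ |cᵢ| M
aᵢ`, and `(∑ u)ᵖ ≤ ∑ uᵖ` because `p ≤ 1`. It therefore suffices to bound `∫ (M a)ᵖ w` uniformly over
atoms and single atoms.

Put `d = ⌊n (q_w/p - 1)⌋`, replaced by `0` if negative. Then `n q_w < p (n + d + 1)`, so some `r >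
q_w` satisfies both `r ≤ q` and `n r < p (n + d + 1)` (`exists_exponent`). The weight condition
enters only through `AvgBound r A w`, which yields local doubling and the growth `w(cube z v) ≲
(v/u)^{nr} w(cube z u)` for `u ≤ v ≤ 4`.

Near its cube `Q` an atom is handled by size: a Vitali covering argument gives the weak type `(r,
r)` bound (`exists_weak`), and Kolmogorov's inequality turns it into an `Lᵖ` bound on sets of
measure `≲ w(Q)` (`exists_lintegral_maxFn_le`). If `Q` has side at least `1` this is enough, since
`M a` vanishes outside the unit neighbourhood of `Q`, of measure `≲ w(Q)`. If `Q` is smaller, the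
vanishing moments and Taylor's formula give `M a ≲ 2^{-k(n+d+1)} w(Q)^{-1/p}` on `2^{k+1}Q \ 2^kQ`.
There `w` has mass `≲ 2^{knr} w(Q)`, and the geometric series converges by the choice of `r`
(`exists_lintegral_compl_le`). A single atom is treated like an atom on the whole space, or vanishes
if `w(ℝⁿ) = ∞`. -/

namespace LocalHardy

/-! ### Cubes and their lattice coverings -/

section Cubes

variable {n : ℕ}

theorem mem_cube {x y : E n} {t : ℝ} : y ∈ cube x t ↔ ∀ i, |y i - x i| ≤ t / 2 := Iff.rfl

theorem cube_eq_preimage (x : E n) (t : ℝ) :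
    cube x t = (WithLp.ofLp : E n → (Fin n → ℝ)) ⁻¹'
      Set.Icc (fun i => x i - t / 2) (fun i => x i + t / 2) := by
  ext y
  simp only [mem_cube, Set.mem_preimage, Set.mem_Icc, Pi.le_def, abs_le]
  constructor
  · intro h
    exact ⟨fun i => by linarith [(h i).1], fun i => by linarith [(h i).2]⟩
  · rintro ⟨h1, h2⟩ i
    exact ⟨by linarith [h1 i], by linarith [h2 i]⟩

theorem isClosed_cube (x : E n) (t : ℝ) : IsClosed (cube x t) := by
  rw [cube_eq_preimage]
  exact isClosed_Icc.preimage (PiLp.continuous_ofLp 2 _)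

theorem measurableSet_cube (x : E n) (t : ℝ) : MeasurableSet (cube x t) :=
  (isClosed_cube x t).measurableSet

theorem isCompact_cube (x : E n) (t : ℝ) : IsCompact (cube x t) := by
  rw [cube_eq_preimage]
  exact (EuclideanSpace.equiv (Fin n) ℝ).toHomeomorph.isCompact_preimage.2 isCompact_Icc

theorem volume_cube (x : E n) (t : ℝ) : volume (cube x t) = ENNReal.ofReal t ^ n := by
  rw [cube_eq_preimage, (PiLp.volume_preserving_ofLp (Fin n)).measure_preimage
    measurableSet_Icc.nullMeasurableSet, Real.volume_Icc_pi]
  simp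

theorem volume_cube_pos (x : E n) {t : ℝ} (ht : 0 < t) : 0 < volume (cube x t) := by
  rw [volume_cube]
  positivity

theorem volume_cube_lt_top (x : E n) (t : ℝ) : volume (cube x t) < ∞ := by
  rw [volume_cube]
  exact ENNReal.pow_lt_top ENNReal.ofReal_lt_top

theorem volume_cube_le_one (x : E n) {t : ℝ} (ht : t ≤ 1) : volume (cube x t) ≤ 1 := by
  rw [volume_cube]
  exact pow_le_one₀ (by positivity) (ENNReal.ofReal_le_one.2 ht)

theorem volume_cube_lt_one (hn : 1 ≤ n) (x : E n) {t : ℝ} (ht : t < 1) :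
    volume (cube x t) < 1 := by
  rw [volume_cube]
  exact pow_lt_one₀ (by positivity) (ENNReal.ofReal_lt_one.2 ht) (by omega)

theorem self_mem_cube (x : E n) {t : ℝ} (ht : 0 ≤ t) : x ∈ cube x t := fun i => by
  simp only [sub_self, abs_zero]; positivity

theorem cube_subset_cube {x z : E n} {s t : ℝ} (h : ∀ i, |z i - x i| ≤ (t - s) / 2) :
    cube z s ⊆ cube x t := fun y hy i => by
  have := abs_sub_le (y i) (z i) (x i)
  linarith [h i, hy i]

theorem cube_mono (x : E n) {s t : ℝ} (h : s ≤ t) : cube x s ⊆ cube x t :=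
  cube_subset_cube fun i => by simp only [sub_self, abs_zero]; linarith

theorem interior_cube_nonempty (x : E n) {t : ℝ} (ht : 0 < t) : (interior (cube x t)).Nonempty := by
  refine ⟨x, mem_interior.2 ⟨Metric.ball x (t / 2), ?_, Metric.isOpen_ball, by simp [ht]⟩⟩
  intro y hy i
  rw [Metric.mem_ball, dist_eq_norm] at hy
  exact ((PiLp.norm_apply_le (y - x) i).trans hy.le)

/-- The point of the lattice `s ℤⁿ` with integer coordinates `k`. -/
noncomputable def latticePoint (s : ℝ) (k : Fin n → ℤ) : E n := WithLp.toLp 2 fun i => s * k i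

/-- The integer points with coordinates bounded by `M`. -/
noncomputable def boxIndex (n M : ℕ) : Finset (Fin n → ℤ) :=
  Fintype.piFinset fun _ => Finset.Icc (-(M : ℤ)) M

/-- Rounding each coordinate of `(y - x) / s` to an integer leaves an error of at most `1/2`, hence
`s/2` after rescaling. -/
theorem cube_subset_iUnion_lattice (x : E n) (M : ℕ) {s : ℝ} (hs : 0 < s) :
    cube x (2 * M * s) ⊆ ⋃ k ∈ boxIndex n M, cube (x + latticePoint s k) s := by
  intro y hy
  have hb : ∀ i, |(y i - x i) / s| ≤ M := fun i => by
    rw [abs_div, abs_of_pos hs, div_le_iff₀ hs]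
    linarith [hy i]
  simp only [Set.mem_iUnion]
  refine ⟨fun i => round ((y i - x i) / s), ?_, ?_⟩
  · simp only [boxIndex, Fintype.mem_piFinset, Finset.mem_Icc]
    intro i
    have h1 := abs_le.1 (abs_sub_round ((y i - x i) / s))
    have h2 := abs_le.1 (hb i)
    constructor
    · have : (-(M : ℤ) - 1 : ℝ) < (round ((y i - x i) / s) : ℝ) := by push_cast; linarith
      have : (-(M : ℤ) - 1) < round ((y i - x i) / s) := by exact_mod_cast this
      omega
    · have : (round ((y i - x i) / s) : ℝ) < ((M : ℤ) + 1 : ℝ) := by push_cast; linarith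
      have : round ((y i - x i) / s) < ((M : ℤ) + 1) := by exact_mod_cast this
      omega
  · intro i
    have h1 := abs_sub_round ((y i - x i) / s)
    have : y i - (x + latticePoint s fun i => round ((y i - x i) / s)) i
        = s * ((y i - x i) / s - round ((y i - x i) / s)) := by
      simp only [latticePoint, PiLp.add_apply]
      field_simp
      ring
    rw [this, abs_mul, abs_of_pos hs]
    nlinarith

end Cubes

/-! ### Weights and the averaging inequality -/

section Weights

variable {n : ℕ} {w : E n → ℝ}

theorem IsWeight.aemeasurable (hw : IsWeight w) :
    AEMeasurable (fun x => ENNReal.ofReal (w x)) :=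
  hw.locallyIntegrable.aestronglyMeasurable.aemeasurable.ennreal_ofReal

theorem wMeasure_absolutelyContinuous (w : E n → ℝ) : wMeasure w ≪ volume :=
  withDensity_absolutelyContinuous _ _

theorem wMeasure_cube_lt_top (hw : IsWeight w) (x : E n) (t : ℝ) : wMeasure w (cube x t) < ∞ := by
  rw [wMeasure, withDensity_apply _ (measurableSet_cube x t)]
  have h := hw.locallyIntegrable.integrableOn_isCompact (isCompact_cube x t)
  exact (lintegral_mono fun y => ENNReal.ofReal_le_of_le_toReal (by simpa using le_abs_self (w y))
    ).trans_lt h.2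

theorem wMeasure_cube_pos (hw : IsWeight w) (x : E n) {t : ℝ} (ht : 0 < t) :
    0 < wMeasure w (cube x t) := by
  rw [wMeasure, pos_iff_ne_zero, Ne,
    withDensity_apply_eq_zero' hw.aemeasurable]
  have h : volume (cube x t) ≤ volume ({x | ENNReal.ofReal (w x) ≠ 0} ∩ cube x t) := by
    refine measure_mono_ae ?_
    filter_upwards [hw.pos_ae] with y hy hyc
    exact ⟨by simpa using hy, hyc⟩
  exact ((volume_cube_pos x ht).trans_le h).ne'

theorem setLIntegral_wMeasure (hw : IsWeight w) {f : E n → ℝ≥0∞} (hf : AEMeasurable f)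
    {s : Set (E n)} (hs : MeasurableSet s) :
    ∫⁻ x in s, f x ∂(wMeasure w) = ∫⁻ x in s, ENNReal.ofReal (w x) * f x := by
  rw [wMeasure, restrict_withDensity hs,
    lintegral_withDensity_eq_lintegral_mul₀ hw.aemeasurable.restrict hf.restrict]
  rfl

/-- The weighted `L^r` averages over cubes of side at most `1` control the unweighted averages. -/
def AvgBound (r : ℝ) (A : ℝ≥0∞) (w : E n → ℝ) : Prop :=
  ∀ (x : E n) (t : ℝ), 0 < t → t ≤ 1 → ∀ f : E n → ℝ≥0∞, AEMeasurable f →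
    (∫⁻ y in cube x t, f y) * wMeasure w (cube x t) ^ (1 / r) ≤
      A * volume (cube x t) * (∫⁻ y in cube x t, f y ^ r ∂(wMeasure w)) ^ (1 / r)

theorem avgBound_of_a1Const (hw : IsWeight w) : AvgBound 1 (a1Const w) w := by
  intro x t ht ht1 f hf
  simp only [div_one, ENNReal.rpow_one]
  set B := essSup (fun y => (ENNReal.ofReal (w y))⁻¹) (volume.restrict (cube x t)) with hB
  -- Write `f = w⁻¹ (w f)` and bound `w⁻¹` by its essential supremum on the cube.
  have h1 : (∫⁻ y in cube x t, f y) ≤ B * ∫⁻ y in cube x t, f y ∂(wMeasure w) := by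
    rw [setLIntegral_wMeasure hw hf (measurableSet_cube x t),
      ← lintegral_const_mul'' (f := fun y => ENNReal.ofReal (w y) * f y) _
        (hw.aemeasurable.mul hf).restrict]
    refine lintegral_mono_ae ?_
    filter_upwards [ENNReal.ae_le_essSup (μ := volume.restrict (cube x t))
      (fun y => (ENNReal.ofReal (w y))⁻¹), ae_restrict_of_ae hw.pos_ae] with y hy hpos
    calc f y = (ENNReal.ofReal (w y))⁻¹ * (ENNReal.ofReal (w y) * f y) := by
          rw [← mul_assoc, ENNReal.inv_mul_cancel (by simpa using hpos) ENNReal.ofReal_ne_top,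
            one_mul]
      _ ≤ B * (ENNReal.ofReal (w y) * f y) := by gcongr
  have h2 : (volume (cube x t))⁻¹ * wMeasure w (cube x t) * B ≤ a1Const w := by
    rw [wMeasure, withDensity_apply _ (measurableSet_cube x t)]
    exact le_iSup_of_le x (le_iSup_of_le t (le_iSup_of_le ht
      (le_iSup_of_le (volume_cube_le_one x ht1) le_rfl)))
  have hv := volume_cube_pos x ht
  have hv' := volume_cube_lt_top x t
  calc (∫⁻ y in cube x t, f y) * wMeasure w (cube x t)
      ≤ (B * ∫⁻ y in cube x t, f y ∂(wMeasure w)) * wMeasure w (cube x t) := by gcongr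
    _ = ((volume (cube x t))⁻¹ * volume (cube x t)) * wMeasure w (cube x t) * B *
        ∫⁻ y in cube x t, f y ∂(wMeasure w) := by
        rw [ENNReal.inv_mul_cancel hv.ne' hv'.ne]; ring
    _ = ((volume (cube x t))⁻¹ * wMeasure w (cube x t) * B) * volume (cube x t) *
        ∫⁻ y in cube x t, f y ∂(wMeasure w) := by ring
    _ ≤ _ := by gcongr

/-- Hölder's inequality applied to `f = (f w^{1/p}) w^{-1/p}`; the second factor produces the dual
integral in `apConst`. -/
theorem avgBound_of_apConst (hw : IsWeight w) {p : ℝ} (hp : 1 < p) :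
    AvgBound p (apConst p w ^ (1 / p)) w := by
  intro x t ht ht1 f hf
  have hp0 : 0 < p := by linarith
  have hpq := Real.HolderConjugate.conjExponent hp
  set q := p.conjExponent with hq
  have hq' : q = p / (p - 1) := rfl
  set W : E n → ℝ≥0∞ := fun y => ENNReal.ofReal (w y) with hW
  set σ : ℝ≥0∞ := ∫⁻ y in cube x t, W y ^ (-(1 / (p - 1))) with hσ
  have hae : ∀ᵐ y ∂(volume.restrict (cube x t)), W y ≠ 0 := by
    filter_upwards [ae_restrict_of_ae hw.pos_ae] with y hy
    simpa [hW] using hy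
  have h1 : (∫⁻ y in cube x t, f y) ≤
      (∫⁻ y in cube x t, f y ^ p ∂(wMeasure w)) ^ (1 / p) * σ ^ (1 / q) := by
    have H := ENNReal.lintegral_mul_le_Lp_mul_Lq (volume.restrict (cube x t)) hpq
      (f := fun y => f y * W y ^ (1 / p)) (g := fun y => W y ^ (-(1 / p)))
      (hf.mul (hw.aemeasurable.pow_const _)).restrict (hw.aemeasurable.pow_const _).restrict
    refine le_trans (le_of_eq ?_) (H.trans (le_of_eq ?_))
    · refine lintegral_congr_ae ?_
      filter_upwards [hae] with y hy
      simp only [Pi.mul_apply]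
      rw [mul_assoc, ← ENNReal.rpow_add _ _ hy ENNReal.ofReal_ne_top]
      simp
    · congr 2
      · rw [setLIntegral_wMeasure hw (hf.pow_const _) (measurableSet_cube x t)]
        refine lintegral_congr fun y => ?_
        rw [ENNReal.mul_rpow_of_nonneg _ _ hp0.le, ← ENNReal.rpow_mul,
          one_div_mul_cancel hp0.ne', ENNReal.rpow_one, mul_comm]
      · refine lintegral_congr fun y => ?_
        rw [← ENNReal.rpow_mul]
        congr 1
        rw [hq']
        have : p - 1 ≠ 0 := by linarith
        field_simp
  have hv := volume_cube_pos x ht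
  have hv' := volume_cube_lt_top x t
  have h2 : (volume (cube x t)) ^ (-p) * wMeasure w (cube x t) * σ ^ (p - 1) ≤ apConst p w := by
    rw [wMeasure, withDensity_apply _ (measurableSet_cube x t)]
    exact le_iSup_of_le x (le_iSup_of_le t (le_iSup_of_le ht
      (le_iSup_of_le (volume_cube_le_one x ht1) le_rfl)))
  have h3 : (volume (cube x t))⁻¹ * wMeasure w (cube x t) ^ (1 / p) * σ ^ (1 / q) ≤
      apConst p w ^ (1 / p) := by
    refine le_trans (le_of_eq ?_) (ENNReal.rpow_le_rpow h2 (by positivity : 0 ≤ 1 / p))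
    rw [ENNReal.mul_rpow_of_nonneg _ _ (by positivity),
      ENNReal.mul_rpow_of_nonneg _ _ (by positivity), ← ENNReal.rpow_mul, ← ENNReal.rpow_mul]
    congr 2
    · rw [neg_mul, mul_one_div_cancel hp0.ne', ENNReal.rpow_neg_one]
    · rw [hq']
      have : p - 1 ≠ 0 := by linarith
      field_simp
  set I := (∫⁻ y in cube x t, f y ^ p ∂(wMeasure w)) ^ (1 / p) with hI
  calc (∫⁻ y in cube x t, f y) * wMeasure w (cube x t) ^ (1 / p)
      ≤ (I * σ ^ (1 / q)) * wMeasure w (cube x t) ^ (1 / p) := by gcongr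
    _ = ((volume (cube x t))⁻¹ * volume (cube x t)) *
        ((I * σ ^ (1 / q)) * wMeasure w (cube x t) ^ (1 / p)) := by
        rw [ENNReal.inv_mul_cancel hv.ne' hv'.ne, one_mul]
    _ = ((volume (cube x t))⁻¹ * wMeasure w (cube x t) ^ (1 / p) * σ ^ (1 / q)) *
        volume (cube x t) * I := by ring
    _ ≤ _ := by gcongr

/-- With respect to the normalised measure `w dx / w(Q)`, `L^p` averages are dominated by `L^r`
averages. -/
theorem AvgBound.mono (hw : IsWeight w) {p r : ℝ} {A : ℝ≥0∞} (hp : 0 < p) (hpr : p ≤ r)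
    (h : AvgBound p A w) : AvgBound r A w := by
  intro x t ht ht1 f hf
  have hr : 0 < r := hp.trans_le hpr
  have hf' : AEStronglyMeasurable f ((wMeasure w).restrict (cube x t)) :=
    (hf.mono_ac (wMeasure_absolutelyContinuous w)).restrict.aestronglyMeasurable
  have H := eLpNorm'_le_eLpNorm'_mul_rpow_measure_univ hp hpr hf'
  simp only [eLpNorm', enorm_eq_self, Measure.restrict_apply_univ] at H
  have hc0 := wMeasure_cube_pos hw x ht
  have hc1 := wMeasure_cube_lt_top hw x t
  set c := wMeasure w (cube x t) with hc
  have h1 := h x t ht ht1 f hf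
  rw [← hc] at h1
  have h2 : c ^ (1 / p - 1 / r) ≠ 0 := by
    simp [ENNReal.rpow_eq_zero_iff, hc0.ne', hc1.ne]
  have h3 : c ^ (1 / p - 1 / r) ≠ ∞ := by
    simp [ENNReal.rpow_eq_top_iff, hc0.ne', hc1.ne]
  rw [← ENNReal.mul_le_mul_iff_left h2 h3]
  calc (∫⁻ y in cube x t, f y) * c ^ (1 / r) * c ^ (1 / p - 1 / r)
      = (∫⁻ y in cube x t, f y) * c ^ (1 / p) := by
        rw [mul_assoc, ← ENNReal.rpow_add _ _ hc0.ne' hc1.ne]; congr 2; ring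
    _ ≤ _ := h1
    _ ≤ A * volume (cube x t) * ((∫⁻ y in cube x t, f y ^ r ∂(wMeasure w)) ^ (1 / r) *
        c ^ (1 / p - 1 / r)) := by gcongr
    _ = _ := by ring

theorem one_le_critIndex (hw : AInftyLoc w) : 1 ≤ critIndex w := by
  obtain ⟨p, hp⟩ := hw
  exact le_csInf ⟨p, hp⟩ fun _ h => h.1

theorem exists_avgBound (hw : AInftyLoc w) {r : ℝ} (hr : critIndex w < r) :
    ∃ A : ℝ≥0∞, A < ∞ ∧ AvgBound r A w := by
  obtain ⟨p, ⟨hp1, hp⟩, hpr⟩ := exists_lt_of_csInf_lt hw hr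
  obtain ⟨hw', ⟨rfl, h⟩ | ⟨hp2, h⟩⟩ := hp
  · exact ⟨_, h, (avgBound_of_a1Const hw').mono hw' one_pos hpr.le⟩
  · exact ⟨_, ENNReal.rpow_lt_top_of_nonneg (by positivity) h.ne,
      (avgBound_of_apConst hw' hp2).mono hw' (by linarith) hpr.le⟩

end Weights

/-! ### Local doubling, growth of the weight, and a Vitali argument -/

section Doubling

variable {n : ℕ} {w : E n → ℝ} {r : ℝ} {A : ℝ≥0∞}

/-- The averaging inequality is tested on the indicator of the smaller cube. -/
theorem AvgBound.wMeasure_cube_le (hA : AvgBound r A w) (hr : 0 < r) {x z : E n} {u v : ℝ}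
    (hu : 0 < u) (hv : 0 < v) (hv1 : v ≤ 1) (hsub : cube z u ⊆ cube x v) :
    wMeasure w (cube x v) ≤
      A ^ r * ENNReal.ofReal ((v / u) ^ (n * r)) * wMeasure w (cube z u) := by
  have h := hA x v hv hv1 ((cube z u).indicator 1)
    (aemeasurable_one.indicator (measurableSet_cube z u))
  have h1 : ∫⁻ y in cube x v, (cube z u).indicator 1 y = volume (cube z u) := by
    rw [lintegral_indicator_one (measurableSet_cube z u),
      Measure.restrict_apply (measurableSet_cube z u), Set.inter_eq_left.2 hsub]
  have h2 : ∫⁻ y in cube x v, (cube z u).indicator 1 y ^ r ∂(wMeasure w)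
      = wMeasure w (cube z u) := by
    have : (fun y => (cube z u).indicator (1 : E n → ℝ≥0∞) y ^ r) = (cube z u).indicator 1 := by
      ext y
      by_cases hy : y ∈ cube z u <;> simp [hy, hr]
    rw [this, lintegral_indicator_one (measurableSet_cube z u),
      Measure.restrict_apply (measurableSet_cube z u), Set.inter_eq_left.2 hsub]
  rw [h1, h2, volume_cube, volume_cube] at h
  have hu' : ENNReal.ofReal u ^ n ≠ 0 := by positivity
  have hu'' : ENNReal.ofReal u ^ n ≠ ∞ := by finiteness
  have h3 : wMeasure w (cube x v) ^ (1 / r) ≤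
      A * ENNReal.ofReal ((v / u) ^ n) * wMeasure w (cube z u) ^ (1 / r) := by
    rw [← ENNReal.mul_le_mul_iff_right hu' hu'']
    refine h.trans (le_of_eq ?_)
    rw [ENNReal.ofReal_pow (by positivity), ENNReal.ofReal_div_of_pos hu,
      ENNReal.div_eq_inv_mul, mul_pow, ← ENNReal.inv_pow]
    calc A * ENNReal.ofReal v ^ n * wMeasure w (cube z u) ^ (1 / r)
        = (ENNReal.ofReal u ^ n * (ENNReal.ofReal u ^ n)⁻¹) *
          (A * ENNReal.ofReal v ^ n * wMeasure w (cube z u) ^ (1 / r)) := by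
          rw [ENNReal.mul_inv_cancel hu' hu'', one_mul]
      _ = _ := by ring
  have h4 := ENNReal.rpow_le_rpow h3 hr.le
  rw [← ENNReal.rpow_mul, one_div_mul_cancel hr.ne', ENNReal.rpow_one,
    ENNReal.mul_rpow_of_nonneg _ _ hr.le, ENNReal.mul_rpow_of_nonneg _ _ hr.le,
    ← ENNReal.rpow_mul, one_div_mul_cancel hr.ne', ENNReal.rpow_one,
    ENNReal.ofReal_rpow_of_nonneg (by positivity) hr.le, ← Real.rpow_natCast,
    ← Real.rpow_mul (by positivity)] at h4
  exact h4

/-- Two cubes of side `s` whose centres differ by at most `s/2` in each coordinate lie in a cube of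
side `2s ≤ 1`, where the local condition applies. Chaining such steps reaches cubes that no cube of
side at most `1` need contain together. -/
theorem AvgBound.wMeasure_shift_le (hA : AvgBound r A w) (hr : 0 < r) (x h : E n) {s : ℝ}
    (hs : 0 < s) (hs1 : s ≤ 1 / 2) (hh : ∀ i, |h i| ≤ s / 2) (j : ℕ) :
    wMeasure w (cube (x + (j : ℝ) • h) s) ≤
      (A ^ r * ENNReal.ofReal (2 ^ (n * r))) ^ j * wMeasure w (cube x s) := by
  induction j with
  | zero => simp
  | succ j ih =>
    set y := x + (j : ℝ) • h with hy
    have h1 : cube (x + ((j + 1 : ℕ) : ℝ) • h) s ⊆ cube y (2 * s) := by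
      refine cube_subset_cube fun i => ?_
      have : (x + ((j + 1 : ℕ) : ℝ) • h) i - y i = h i := by
        simp only [hy, PiLp.add_apply, PiLp.smul_apply, smul_eq_mul]
        push_cast
        ring
      rw [this]
      linarith [hh i]
    have h2 := hA.wMeasure_cube_le hr hs (by linarith : 0 < 2 * s) (by linarith)
      (cube_mono y (by linarith : s ≤ 2 * s))
    rw [mul_div_assoc, div_self hs.ne', mul_one] at h2
    calc _ ≤ wMeasure w (cube y (2 * s)) := measure_mono h1
      _ ≤ _ := h2
      _ ≤ A ^ r * ENNReal.ofReal (2 ^ (n * r)) *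
        ((A ^ r * ENNReal.ofReal (2 ^ (n * r))) ^ j * wMeasure w (cube x s)) := by gcongr
      _ = _ := by ring

theorem AvgBound.exists_doubling (hA : AvgBound r A w) (hr : 0 < r) (hAt : A < ∞) (M : ℕ) :
    ∃ C : ℝ≥0∞, C < ∞ ∧ ∀ (z : E n) (s : ℝ), 0 < s → s ≤ 1 / 2 →
      wMeasure w (cube z (2 * M * s)) ≤ C * wMeasure w (cube z s) := by
  set B : ℝ≥0∞ := A ^ r * ENNReal.ofReal (2 ^ (n * r)) with hB
  have hBt : B < ∞ := ENNReal.mul_lt_top (ENNReal.rpow_lt_top_of_nonneg hr.le hAt.ne)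
    ENNReal.ofReal_lt_top
  refine ⟨(boxIndex n M).card * B ^ (2 * M),
    ENNReal.mul_lt_top (ENNReal.natCast_lt_top _) (ENNReal.pow_lt_top hBt), fun z s hs hs1 => ?_⟩
  refine (measure_mono (cube_subset_iUnion_lattice z M hs)).trans
    ((measure_biUnion_finset_le _ _).trans ?_)
  rw [mul_assoc, ← nsmul_eq_mul]
  refine Finset.sum_le_card_nsmul _ _ _ fun k hk => ?_
  rcases Nat.eq_zero_or_pos M with rfl | hM
  · have hk0 : latticePoint s k = 0 := by
      simp only [boxIndex, Fintype.mem_piFinset] at hk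
      ext i
      have := hk i
      simp only [CharP.cast_eq_zero, neg_zero, Finset.Icc_self, Finset.mem_singleton] at this
      simp [latticePoint, this]
    simp [hk0]
  have hM' : (0 : ℝ) < M := by exact_mod_cast hM
  -- The displacement has coordinates at most `M s`, so `2M` equal steps each move by at most `s/2`.
  have H := hA.wMeasure_shift_le hr z ((1 / (2 * M) : ℝ) • latticePoint s k) hs hs1 (fun i => ?_)
    (2 * M)
  · rw [smul_smul, Nat.cast_mul, Nat.cast_ofNat, mul_one_div_cancel (by positivity),
      one_smul] at H
    exact H
  · simp only [boxIndex, Fintype.mem_piFinset, Finset.mem_Icc] at hk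
    have hki : |(k i : ℝ)| ≤ M := abs_le.2 ⟨by exact_mod_cast (hk i).1, by exact_mod_cast (hk i).2⟩
    simp only [latticePoint, PiLp.smul_apply, smul_eq_mul]
    rw [abs_mul, abs_mul, abs_of_pos hs, abs_of_pos (by positivity)]
    calc 1 / (2 * (M : ℝ)) * (s * |(k i : ℝ)|) ≤ 1 / (2 * (M : ℝ)) * (s * M) := by gcongr
      _ = s / 2 := by field_simp

theorem AvgBound.exists_growth (hA : AvgBound r A w) (hr : 0 < r) (hAt : A < ∞) :
    ∃ C : ℝ≥0∞, C < ∞ ∧ ∀ (z : E n) (u v : ℝ), 0 < u → u ≤ v → v ≤ 4 →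
      wMeasure w (cube z v) ≤ C * ENNReal.ofReal ((v / u) ^ (n * r)) * wMeasure w (cube z u) := by
  obtain ⟨C, hC, h⟩ := hA.exists_doubling hr hAt 4
  refine ⟨C * (1 + A ^ r), ENNReal.mul_lt_top hC (ENNReal.add_lt_top.2
    ⟨ENNReal.one_lt_top, ENNReal.rpow_lt_top_of_nonneg hr.le hAt.ne⟩), fun z u v hu huv hv => ?_⟩
  have hv0 : 0 < v := hu.trans_le huv
  -- The side `v ≤ 4` may exceed `1`: doubling first reduces it to `v/8 ≤ 1/2`, within reach of the
  -- local condition.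
  have h1 := h z (v / 8) (by positivity) (by linarith)
  rw [show 2 * ((4 : ℕ) : ℝ) * (v / 8) = v by push_cast; ring] at h1
  have hone : (1 : ℝ≥0∞) ≤ ENNReal.ofReal ((v / u) ^ (n * r)) := by
    rw [ENNReal.one_le_ofReal]
    exact Real.one_le_rpow ((one_le_div hu).2 huv) (by positivity)
  refine h1.trans ?_
  rw [mul_assoc, mul_assoc]
  gcongr
  rcases le_total (v / 8) u with h8 | h8
  · calc wMeasure w (cube z (v / 8)) ≤ wMeasure w (cube z u) := measure_mono (cube_mono z h8)
      _ = 1 * (1 * wMeasure w (cube z u)) := by simp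
      _ ≤ _ := by gcongr; simp
  · refine (hA.wMeasure_cube_le hr hu (by positivity) (by linarith) (cube_mono z h8)).trans ?_
    rw [mul_assoc]
    gcongr
    · exact le_add_self
    · linarith

/-- Each point may be off its cube, at distance comparable to the side. Disjoint cubes are selected
by Vitali's lemma; their enlargements cover `F`, doubling removes the enlargement, and disjointness
sums the `ν`-masses. -/
theorem AvgBound.exists_vitali (hA : AvgBound r A w) (hr : 0 < r) (hAt : A < ∞) (K : ℕ) :
    ∃ C : ℝ≥0∞, C < ∞ ∧ ∀ (ν : Measure (E n)) (F : Set (E n)),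
      (∀ x ∈ F, ∃ (z : E n) (s : ℝ), 0 < s ∧ s ≤ 1 / 2 ∧ (∀ i, |x i - z i| ≤ K * s) ∧
        wMeasure w (cube z s) ≤ ν (cube z s)) → wMeasure w F ≤ C * ν Set.univ := by
  -- If the cube of `x` meets a selected one of side `s_b`, with `s_x ≤ 2 s_b`, then `x` is within
  -- `K s_x + s_x/2 + s_b/2 ≤ (2K + 2) s_b` of the selected centre in each coordinate.
  obtain ⟨C, hC, hdbl⟩ := hA.exists_doubling hr hAt (2 * K + 2)
  refine ⟨C, hC, fun ν F hF => ?_⟩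
  choose! z s hs0 hs1 hxz hν using hF
  obtain ⟨u, huF, hdisj, hcov⟩ := Vitali.exists_disjoint_subfamily_covering_enlargement
    (fun x => cube (z x) (s x)) F s 2 one_lt_two (fun x hx => (hs0 x hx).le) (1 / 2) hs1
    (fun x hx => ⟨z x, self_mem_cube _ (hs0 x hx).le⟩)
  have hcount : u.Countable := hdisj.countable_of_nonempty_interior
    fun x hx => interior_cube_nonempty _ (hs0 x (huF hx))
  have hsub : F ⊆ ⋃ x ∈ u, cube (z x) (2 * (2 * K + 2 : ℕ) * s x) := by
    intro x hx
    obtain ⟨b, hb, ⟨y, hy1, hy2⟩, hle⟩ := hcov x hx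
    simp only [Set.mem_iUnion]
    refine ⟨b, hb, fun i => ?_⟩
    have e1 := hxz x hx i
    have e2 := hy1 i
    have e3 := hy2 i
    have e4 : |x i - z b i| ≤ |x i - z x i| + (|y i - z x i| + |y i - z b i|) := by
      have := abs_sub_le (x i) (z x i) (z b i)
      have h2 := abs_sub_le (z x i) (y i) (z b i)
      rw [abs_sub_comm (z x i) (y i)] at h2
      linarith
    have e5 : (K : ℝ) * s x ≤ K * (2 * s b) := by gcongr
    have := hs0 b (huF hb)
    push_cast
    nlinarith
  calc wMeasure w F ≤ wMeasure w (⋃ x ∈ u, cube (z x) (2 * (2 * K + 2 : ℕ) * s x)) :=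
        measure_mono hsub
    _ ≤ ∑' x : u, wMeasure w (cube (z x) (2 * (2 * K + 2 : ℕ) * s x)) :=
        measure_biUnion_le _ hcount _
    _ ≤ ∑' x : u, C * ν (cube (z x) (s x)) := by
        refine ENNReal.tsum_le_tsum fun x => ?_
        refine (hdbl _ _ (hs0 x (huF x.2)) (hs1 x (huF x.2))).trans ?_
        exact mul_le_mul_right (hν x (huF x.2)) C
    _ = C * ν (⋃ x ∈ u, cube (z x) (s x)) := by
        rw [ENNReal.tsum_mul_left, measure_biUnion hcount hdisj fun x _ => measurableSet_cube _ _]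
    _ ≤ C * ν Set.univ := by gcongr; exact Set.subset_univ _

/-- The measure of a cube of side `t ≥ 1` controls that of its unit neighbourhood. -/
theorem AvgBound.exists_neighbourhood (hA : AvgBound r A w) (hr : 0 < r) (hAt : A < ∞) :
    ∃ C : ℝ≥0∞, C < ∞ ∧ ∀ (x : E n) (t : ℝ), 1 ≤ t →
      wMeasure w (cube x (t + 2)) ≤ C * wMeasure w (cube x t) := by
  obtain ⟨C, hC, h⟩ := hA.exists_vitali hr hAt 3
  refine ⟨C, hC, fun x t ht => ?_⟩
  have H := h ((wMeasure w).restrict (cube x t)) (cube x (t + 2)) fun y hy => ?_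
  · simpa using H
  have ht2 : (0 : ℝ) < t + 2 := by linarith
  -- Contracting `y` towards `x` by `ρ` puts a cube of side `1/2` inside `cube x t`. Each coordinate
  -- moves by at most `5/4`, below `3 · 1/2`; hence `K = 3`.
  set ρ : ℝ := (t - 1 / 2) / (t + 2) with hρ
  have hρ0 : 0 ≤ ρ := div_nonneg (by linarith) ht2.le
  have hρ1 : ρ * (t + 2) = t - 1 / 2 := by rw [hρ]; field_simp
  have hρ2 : ρ ≤ 1 := by rw [hρ, div_le_one ht2]; linarith
  refine ⟨x + ρ • (y - x), 1 / 2, by norm_num, le_rfl, fun i => ?_, ?_⟩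
  · have : y i - (x + ρ • (y - x)) i = (1 - ρ) * (y i - x i) := by
      simp only [PiLp.add_apply, PiLp.smul_apply, PiLp.sub_apply, smul_eq_mul]; ring
    rw [this, abs_mul, abs_of_nonneg (by linarith)]
    have := mul_le_mul_of_nonneg_left (hy i) (by linarith : 0 ≤ 1 - ρ)
    push_cast
    linarith
  · rw [Measure.restrict_apply (measurableSet_cube _ _), Set.inter_eq_left.2]
    refine cube_subset_cube fun i => ?_
    have : (x + ρ • (y - x)) i - x i = ρ * (y i - x i) := by
      simp only [PiLp.add_apply, PiLp.smul_apply, PiLp.sub_apply, smul_eq_mul]; ring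
    rw [this, abs_mul, abs_of_nonneg hρ0]
    have := mul_le_mul_of_nonneg_left (hy i) hρ0
    linarith

end Doubling

/-! ### From weak type to strong type on sets of finite measure -/

theorem exists_two_pow_mul_lt_le {l g : ℝ≥0∞} (hl : l ≠ 0) (hg : g ≠ ∞) (hlg : l < g) :
    ∃ k : ℕ, 2 ^ k * l < g ∧ g ≤ 2 ^ (k + 1) * l := by
  have hex : ∃ k : ℕ, g ≤ 2 ^ k * l := by
    obtain ⟨m, hm⟩ := ENNReal.exists_nat_mul_gt hl hg
    refine ⟨m, hm.le.trans ?_⟩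
    gcongr
    exact_mod_cast Nat.lt_two_pow_self.le
  classical
  obtain ⟨k, hk⟩ : ∃ k, Nat.find hex = k + 1 := by
    refine Nat.exists_eq_succ_of_ne_zero fun h0 => ?_
    have := Nat.find_spec hex
    rw [h0, pow_zero, one_mul] at this
    exact absurd this (not_le.2 hlg)
  exact ⟨k, not_le.1 (Nat.find_min hex (by omega)), hk ▸ Nat.find_spec hex⟩

theorem rpow_le_add_tsum_indicator {α : Type*} {p : ℝ} (hp : 0 < p) (g : α → ℝ≥0∞)
    {l : ℝ≥0∞} (hl : l ≠ 0) (hl' : l ≠ ∞) (x : α) :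
    g x ^ p ≤ l ^ p +
      ∑' k : ℕ, {x | 2 ^ k * l < g x}.indicator (fun _ => (2 ^ (k + 1) * l) ^ p) x := by
  rcases le_or_gt (g x) l with h | h
  · exact (ENNReal.rpow_le_rpow h hp.le).trans le_self_add
  refine le_trans ?_ le_add_self
  -- Where `g = ∞` every indicator is active, and the sum of terms at least `l ^ p` diverges.
  by_cases hg : g x = ∞
  · have hlp : l ^ p ≠ 0 := by simp [ENNReal.rpow_eq_zero_iff, hl, hl']
    refine le_top.trans ((ENNReal.tsum_const_eq_top_of_ne_zero (α := ℕ) hlp).ge.trans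
      (ENNReal.tsum_le_tsum fun k => ?_))
    rw [Set.indicator_of_mem]
    · refine ENNReal.rpow_le_rpow ?_ hp.le
      calc l = 1 * l := (one_mul l).symm
        _ ≤ 2 ^ (k + 1) * l := by gcongr; exact one_le_pow₀ one_le_two
    · rw [Set.mem_ofPred_eq, hg]
      exact ENNReal.mul_lt_top (by finiteness) hl'.lt_top
  · obtain ⟨k, hk1, hk2⟩ := exists_two_pow_mul_lt_le hl hg h
    refine le_trans ?_ (ENNReal.le_tsum k)
    rw [Set.indicator_of_mem (by exact hk1)]
    exact ENNReal.rpow_le_rpow hk2 hp.le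

/-- **Kolmogorov's inequality**: a weak type `r` bound gives a strong bound of exponent `p < r` on
sets of finite measure. -/
theorem exists_lintegral_rpow_le_of_weak {p r : ℝ} (hp : 0 < p) (hpr : p < r) :
    ∃ C : ℝ≥0∞, C < ∞ ∧ ∀ {α : Type*} [MeasurableSpace α] (μ : Measure α) (g : α → ℝ≥0∞)
      (S : Set α) (m l : ℝ≥0∞), Measurable g → μ S ≤ m → l ≠ 0 →
      l ≠ ∞ → (∀ k : ℕ, μ {x | 2 ^ k * l < g x} ≤ m * ENNReal.ofReal (2 ^ (-r)) ^ k) →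
      ∫⁻ x in S, g x ^ p ∂μ ≤ C * (l ^ p * m) := by
  -- Level `2^k l` contributes `2^{kp}` from the size of `g` and `2^{-kr}` from the weak bound.
  set b : ℝ≥0∞ := ENNReal.ofReal (2 ^ (p - r)) with hb
  have hb1 : b < 1 := by
    rw [hb, ENNReal.ofReal_lt_one]
    exact Real.rpow_lt_one_of_one_lt_of_neg one_lt_two (by linarith)
  refine ⟨1 + 2 ^ p * ∑' k : ℕ, b ^ k, ?_, ?_⟩
  · rw [ENNReal.tsum_geometric]
    refine ENNReal.add_lt_top.2 ⟨ENNReal.one_lt_top, ENNReal.mul_lt_top ?_ ?_⟩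
    · exact ENNReal.rpow_lt_top_of_nonneg hp.le ENNReal.ofNat_ne_top
    · exact ENNReal.inv_lt_top.2 (tsub_pos_of_lt hb1)
  intro α _ μ g S m l hg hm hl hl' hweak
  have hset : ∀ k : ℕ, MeasurableSet {x | 2 ^ k * l < g x} :=
    fun k => measurableSet_lt measurable_const hg
  calc ∫⁻ x in S, g x ^ p ∂μ
      ≤ ∫⁻ x in S, (l ^ p + ∑' k : ℕ,
          {x | 2 ^ k * l < g x}.indicator (fun _ => (2 ^ (k + 1) * l) ^ p) x) ∂μ :=
        lintegral_mono fun x => rpow_le_add_tsum_indicator hp g hl hl' x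
    _ = l ^ p * μ S + ∑' k : ℕ, (2 ^ (k + 1) * l) ^ p * μ.restrict S {x | 2 ^ k * l < g x} := by
        rw [lintegral_add_left measurable_const, setLIntegral_const,
          lintegral_tsum fun k => (measurable_const.indicator (hset k)).aemeasurable]
        simp_rw [lintegral_indicator_const (hset _)]
    _ ≤ l ^ p * m + ∑' k : ℕ, 2 ^ p * b ^ k * (l ^ p * m) := by
        refine add_le_add (by gcongr) (ENNReal.tsum_le_tsum fun k => ?_)
        calc (2 ^ (k + 1) * l) ^ p * μ.restrict S {x | 2 ^ k * l < g x}
            ≤ (2 ^ (k + 1) * l) ^ p * (m * ENNReal.ofReal (2 ^ (-r)) ^ k) := by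
              gcongr
              exact (Measure.restrict_apply_le _ _).trans (hweak k)
          _ = _ := by
              have h2 : b = 2 ^ p * ENNReal.ofReal (2 ^ (-r)) := by
                rw [hb, sub_eq_add_neg, Real.rpow_add two_pos, ENNReal.ofReal_mul (by positivity),
                  ← ENNReal.ofReal_rpow_of_pos two_pos, ENNReal.ofReal_ofNat]
              rw [ENNReal.mul_rpow_of_nonneg _ _ hp.le, h2, mul_pow, pow_succ,
                ENNReal.mul_rpow_of_nonneg _ _ hp.le, ← ENNReal.rpow_natCast 2 k,
                ← ENNReal.rpow_mul, mul_comm (k : ℝ) p, ENNReal.rpow_mul, ENNReal.rpow_natCast]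
              ring
    _ = _ := by
        rw [ENNReal.tsum_mul_right, ENNReal.tsum_mul_left]
        ring

/-! ### Taylor expansion of test functions -/

section Taylor

variable {n : ℕ}

/-- The class `testClass` controls derivatives only along basis vectors, so directional derivatives
are expanded by multilinearity. -/
theorem iteratedFDeriv_const_eq_sum (φ : Test n) (k : ℕ) (z h : E n) :
    iteratedFDeriv ℝ k (φ : E n → ℂ) z (fun _ => h) = ∑ j : Fin k → Fin n,
      (∏ i, h (j i)) • iteratedFDeriv ℝ k (φ : E n → ℂ) z
        (fun i => EuclideanSpace.single (j i) (1 : ℝ)) := by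
  have hh : h = ∑ i, h i • EuclideanSpace.single i (1 : ℝ) := by
    ext l
    simp [Finset.sum_apply, Pi.single_apply]
  conv_lhs => rw [hh]
  rw [ContinuousMultilinearMap.map_sum]
  exact Finset.sum_congr rfl fun j _ => ContinuousMultilinearMap.map_smul_univ _ _ _

theorem norm_iteratedFDeriv_const_le {N k : ℕ} (hk : k ≤ N + 1) {φ : Test n}
    (hφ : φ ∈ testClass N) (z h : E n) :
    ‖iteratedFDeriv ℝ k (φ : E n → ℂ) z (fun _ => h)‖ ≤ (∑ i, |h i|) ^ k := by
  rw [iteratedFDeriv_const_eq_sum, Fintype.sum_pow]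
  refine (norm_sum_le _ _).trans (Finset.sum_le_sum fun j _ => ?_)
  rw [norm_smul, Real.norm_eq_abs, Finset.abs_prod]
  exact mul_le_of_le_one_right (Finset.prod_nonneg fun _ _ => abs_nonneg _) (hφ.2.2 k hk j z)

theorem iteratedDeriv_line (φ : Test n) (k : ℕ) (z h : E n) (θ : ℝ) :
    iteratedDeriv k (fun θ : ℝ => φ (z + θ • h)) θ =
      iteratedFDeriv ℝ k (φ : E n → ℂ) (z + θ • h) (fun _ => h) := by
  have hsm : ContDiff ℝ k (fun y => φ (z + y)) := by
    have := φ.contDiff.of_le (by exact_mod_cast le_top : (k : WithTop ℕ∞) ≤ ((⊤ : ℕ∞) : WithTop ℕ∞))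
    fun_prop
  have := ContinuousLinearMap.iteratedFDeriv_comp_right
    (ContinuousLinearMap.toSpanSingleton ℝ h) hsm θ (i := k) le_rfl
  rw [iteratedDeriv_eq_iteratedFDeriv]
  have e : (fun θ : ℝ => φ (z + θ • h)) =
      (fun y => φ (z + y)) ∘ (ContinuousLinearMap.toSpanSingleton ℝ h) := by
    ext; simp
  rw [e, this, iteratedFDeriv_comp_add_left]
  simp

/-- One-variable Taylor along the segment from `z` to `z + h`; the remainder uses derivatives of
order `d + 1 ≤ N + 1`, the range controlled by `testClass N`. -/
theorem norm_sub_taylor_le {N d : ℕ} (hd : d ≤ N) {φ : Test n} (hφ : φ ∈ testClass N)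
    (z h : E n) :
    ‖φ (z + h) - ∑ k ∈ Finset.range (d + 1), ((k.factorial : ℝ)⁻¹) •
      iteratedFDeriv ℝ k (φ : E n → ℂ) z (fun _ => h)‖ ≤ (∑ i, |h i|) ^ (d + 1) := by
  set g : ℝ → ℂ := fun θ => φ (z + θ • h) with hg
  have hsm : ∀ k : ℕ, ContDiff ℝ k g := fun k => by
    have := φ.contDiff.of_le (by exact_mod_cast le_top : (k : WithTop ℕ∞) ≤ ((⊤ : ℕ∞) : WithTop ℕ∞))
    fun_prop
  have hI : ∀ k, ∀ θ ∈ Set.Icc (0 : ℝ) 1, iteratedDerivWithin k g (Set.Icc 0 1) θ =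
      iteratedFDeriv ℝ k (φ : E n → ℂ) (z + θ • h) (fun _ => h) := fun k θ hθ => by
    rw [iteratedDerivWithin_eq_iteratedDeriv (uniqueDiffOn_Icc zero_lt_one)
      (hsm k).contDiffAt hθ, iteratedDeriv_line]
  have H := taylor_mean_remainder_bound (f := g) (C := (∑ i, |h i|) ^ (d + 1)) (n := d)
    zero_le_one (by exact_mod_cast (hsm (d + 1)).contDiffOn) (Set.right_mem_Icc.2 zero_le_one)
    (fun θ hθ => by
      rw [hI _ θ hθ]
      exact norm_iteratedFDeriv_const_le (by omega) hφ _ _)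
  rw [taylor_within_apply] at H
  have e : ∑ k ∈ Finset.range (d + 1), ((k.factorial : ℝ)⁻¹ * (1 - 0) ^ k) •
        iteratedDerivWithin k g (Set.Icc 0 1) 0 =
      ∑ k ∈ Finset.range (d + 1), ((k.factorial : ℝ)⁻¹) •
        iteratedFDeriv ℝ k (φ : E n → ℂ) z (fun _ => h) := by
    refine Finset.sum_congr rfl fun k _ => ?_
    rw [hI k 0 (by simp)]
    simp
  rw [e] at H
  have h0 : 0 ≤ (∑ i, |h i|) ^ (d + 1) := by positivity
  refine (by simpa [hg] using H : _ ≤ (∑ i, |h i|) ^ (d + 1) / (d.factorial : ℝ)).trans ?_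
  exact div_le_self h0 (by exact_mod_cast Nat.one_le_iff_ne_zero.2 d.factorial_ne_zero)

end Taylor

/-! ### Pairing functions with dilated test functions -/

section Dilate

variable {n : ℕ}

theorem dilate_apply (φ : Test n) {t : ℝ} (ht : 0 < t) (x y : E n) :
    dilate φ t ht x y = ((t ^ n)⁻¹ : ℝ) • φ (t⁻¹ • (x - y)) := rfl

theorem apply_eq_zero_of_testClass {N : ℕ} {φ : Test n} (hφ : φ ∈ testClass N) {z : E n} {i : Fin n}
    (hz : 1 ≤ |z i|) : φ z = 0 := by
  refine image_eq_zero_of_notMem_tsupport fun h => ?_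
  have h1 := hφ.1 h
  rw [Metric.mem_ball, dist_zero_right] at h1
  have := PiLp.norm_apply_le z i
  rw [Real.norm_eq_abs] at this
  linarith

theorem dilate_eq_zero {N : ℕ} {φ : Test n} (hφ : φ ∈ testClass N) {t : ℝ} (ht : 0 < t)
    {x y : E n} {i : Fin n} (hi : t ≤ |x i - y i|) : dilate φ t ht x y = 0 := by
  rw [dilate_apply, apply_eq_zero_of_testClass hφ (i := i), smul_zero]
  simp only [PiLp.smul_apply, PiLp.sub_apply, smul_eq_mul]
  rw [abs_mul, abs_of_pos (inv_pos.2 ht), inv_mul_eq_div]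
  exact (one_le_div ht).2 hi

theorem norm_apply_le_one_of_testClass {N : ℕ} {φ : Test n} (hφ : φ ∈ testClass N) (z : E n) :
    ‖φ z‖ ≤ 1 := by
  simpa using norm_iteratedFDeriv_const_le (Nat.zero_le _) hφ z 0 (k := 0)

theorem enorm_dilate_le {N : ℕ} {φ : Test n} (hφ : φ ∈ testClass N) {t : ℝ} (ht : 0 < t)
    (x y : E n) :
    ‖dilate φ t ht x y‖ₑ ≤ (ENNReal.ofReal t ^ n)⁻¹ := by
  rw [dilate_apply, ← ofReal_norm, norm_smul, norm_inv, norm_pow, Real.norm_of_nonneg ht.le,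
    ← ENNReal.ofReal_pow ht.le, ← ENNReal.ofReal_inv_of_pos (by positivity)]
  exact ENNReal.ofReal_le_ofReal
    (mul_le_of_le_one_right (by positivity) (norm_apply_le_one_of_testClass hφ _))

theorem enorm_integral_dilate_le {N : ℕ} {φ : Test n} (hφ : φ ∈ testClass N) {t : ℝ} (ht : 0 < t)
    (a : E n → ℂ) (x : E n) :
    ‖∫ y, a y * dilate φ t ht x y‖ₑ ≤
      (ENNReal.ofReal t ^ n)⁻¹ * ∫⁻ y in cube x (2 * t), ‖a y‖ₑ := by
  refine (enorm_integral_le_lintegral_enorm _).trans ?_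
  rw [← lintegral_const_mul' _ _ (by simp [ht]),
    ← lintegral_indicator (measurableSet_cube x (2 * t))]
  refine lintegral_mono fun y => ?_
  by_cases hy : y ∈ cube x (2 * t)
  · rw [Set.indicator_of_mem hy, enorm_mul, mul_comm]
    gcongr
    exact enorm_dilate_le hφ ht x y
  · rw [mem_cube] at hy
    push Not at hy
    obtain ⟨i, hi⟩ := hy
    rw [dilate_eq_zero hφ ht (i := i)]
    · simp
    · rw [abs_sub_comm]; linarith

/-- A compactly supported function with vanishing moments is orthogonal to polynomials. -/
theorem integral_mul_eval_eq_zero {a : E n → ℂ} {s : ℕ} {x₀ : E n} {r : ℝ} (ha : Integrable a)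
    (hsupp : ∀ᵐ x, x ∉ cube x₀ r → a x = 0)
    (hmom : ∀ α : Fin n → ℕ, ∑ i, α i ≤ s → ∫ x, a x * ((∏ i, x i ^ α i : ℝ) : ℂ) = 0)
    (P : MvPolynomial (Fin n) ℝ) (hP : P.totalDegree ≤ s) :
    Integrable (fun x => a x * ((MvPolynomial.eval (fun i => x i) P : ℝ) : ℂ)) ∧
      ∫ x, a x * ((MvPolynomial.eval (fun i => x i) P : ℝ) : ℂ) = 0 := by
  have h_int : ∀ α : Fin n → ℕ, Integrable fun x => a x * ((∏ i, x i ^ α i : ℝ) : ℂ) := fun α => by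
    have hc : Continuous fun x : E n => ((∏ i, x i ^ α i : ℝ) : ℂ) := by fun_prop
    obtain ⟨C, hC⟩ := (isCompact_cube x₀ r).exists_bound_of_continuousOn hc.continuousOn
    refine (ha.norm.mul_const C).mono' (ha.aestronglyMeasurable.mul hc.aestronglyMeasurable) ?_
    filter_upwards [hsupp] with x hx
    by_cases h : x ∈ cube x₀ r
    · rw [norm_mul]
      gcongr
      exact hC x h
    · simp [hx h]
  have e : (fun x : E n => a x * ((MvPolynomial.eval (fun i => x i) P : ℝ) : ℂ)) = fun x =>
      ∑ d ∈ P.support, ((P.coeff d : ℝ) : ℂ) * (a x * ((∏ i, x i ^ d i : ℝ) : ℂ)) := by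
    ext x
    rw [MvPolynomial.eval_eq']
    push_cast
    rw [Finset.mul_sum]
    exact Finset.sum_congr rfl fun d _ => by ring
  rw [e]
  refine ⟨integrable_finsetSum _ fun d _ => (h_int d).const_mul _, ?_⟩
  rw [integral_finsetSum _ fun (d : Fin n →₀ ℕ) _ => (h_int d).const_mul ((P.coeff d : ℝ) : ℂ)]
  refine Finset.sum_eq_zero fun d hd => ?_
  rw [integral_const_mul, hmom d, mul_zero]
  refine le_trans ?_ ((MvPolynomial.le_totalDegree hd).trans hP)
  rw [Finsupp.sum_fintype _ _ fun _ => rfl]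

/-- The Taylor polynomial of `y ↦ φ((x - y)/t)` at the centre `x₀` has degree at most `d` in `y`, so
the moments annihilate it. On the cube the remainder is at most `(n r / (2t))^{d+1}`. -/
theorem norm_integral_dilate_le_of_moments {N d : ℕ} (hd : d ≤ N) {φ : Test n}
    (hφ : φ ∈ testClass N) {a : E n → ℂ} {x₀ : E n} {r : ℝ} (ha : Integrable a)
    (hsupp : ∀ᵐ x, x ∉ cube x₀ r → a x = 0)
    (hmom : ∀ α : Fin n → ℕ, ∑ i, α i ≤ d → ∫ x, a x * ((∏ i, x i ^ α i : ℝ) : ℂ) = 0)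
    {t : ℝ} (ht : 0 < t) (x : E n) :
    ‖∫ y, a y * dilate φ t ht x y‖ ≤
      (t ^ n)⁻¹ * (n * (r / (2 * t))) ^ (d + 1) * ∫ y, ‖a y‖ := by
  set z : E n := t⁻¹ • (x - x₀) with hz
  set h : E n → E n := fun y => t⁻¹ • (x₀ - y) with hh
  have hzh : ∀ y, t⁻¹ • (x - y) = z + h y := fun y => by
    rw [hz, hh, ← smul_add]; congr 1; abel
  set T : E n → ℂ := fun y => ∑ k ∈ Finset.range (d + 1), ((k.factorial : ℝ)⁻¹) •
    iteratedFDeriv ℝ k (φ : E n → ℂ) z (fun _ => h y) with hT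
  have hpoly : ∀ (k : ℕ) (j : Fin k → Fin n), k ≤ d →
      Integrable (fun y => a y * ((∏ i, h y (j i) : ℝ) : ℂ)) ∧
      ∫ y, a y * ((∏ i, h y (j i) : ℝ) : ℂ) = 0 := fun k j hk => by
    have H := integral_mul_eval_eq_zero ha hsupp hmom
      (∏ i : Fin k, (MvPolynomial.C t⁻¹ * (MvPolynomial.C (x₀ (j i)) - MvPolynomial.X (j i)))) (by
        refine (MvPolynomial.totalDegree_finsetProd _ _).trans ?_
        refine (Finset.sum_le_card_nsmul _ _ 1 fun i _ => ?_).trans (by simpa using hk)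
        refine (MvPolynomial.totalDegree_mul _ _).trans ?_
        rw [MvPolynomial.totalDegree_C, zero_add]
        refine (MvPolynomial.totalDegree_sub _ _).trans ?_
        simp [MvPolynomial.totalDegree_C])
    simpa [map_prod, hh] using H
  have hTe : (fun y => a y * T y) = fun y => ∑ k ∈ Finset.range (d + 1), ∑ j : Fin k → Fin n,
      (((k.factorial : ℝ)⁻¹ : ℝ) * iteratedFDeriv ℝ k (φ : E n → ℂ) z
        (fun i => EuclideanSpace.single (j i) (1 : ℝ))) * (a y * ((∏ i, h y (j i) : ℝ) : ℂ)) := by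
    ext y
    simp only [hT]
    rw [Finset.mul_sum]
    refine Finset.sum_congr rfl fun k _ => ?_
    rw [iteratedFDeriv_const_eq_sum, Finset.smul_sum, Finset.mul_sum]
    refine Finset.sum_congr rfl fun j _ => ?_
    simp only [Complex.real_smul]
    ring
  have hTint : Integrable (fun y => a y * T y) := by
    rw [hTe]
    refine integrable_finsetSum _ fun k hk => integrable_finsetSum _ fun j _ =>
      (hpoly k j ?_).1.const_mul _
    exact Nat.lt_succ_iff.1 (Finset.mem_range.1 hk)
  have hT0 : ∫ y, a y * T y = 0 := by
    rw [hTe, integral_finsetSum _ fun k hk => integrable_finsetSum _ fun j _ =>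
      (hpoly k j (Nat.lt_succ_iff.1 (Finset.mem_range.1 hk))).1.const_mul _]
    refine Finset.sum_eq_zero fun k hk => ?_
    have hk' := Nat.lt_succ_iff.1 (Finset.mem_range.1 hk)
    rw [integral_finsetSum _ fun j _ => (hpoly k j hk').1.const_mul _]
    refine Finset.sum_eq_zero fun j _ => ?_
    rw [integral_const_mul, (hpoly k j hk').2, mul_zero]
  have hφint : Integrable (fun y => a y * φ (z + h y)) := by
    have hc : Continuous fun y => φ (z + h y) := by
      have := φ.continuous
      fun_prop
    exact ha.mul_bdd (c := 1) hc.aestronglyMeasurable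
      (ae_of_all _ fun y => norm_apply_le_one_of_testClass hφ _)
  have e1 : ∫ y, a y * dilate φ t ht x y =
      ((t ^ n)⁻¹ : ℝ) • ∫ y, a y * (φ (z + h y) - T y) := by
    simp_rw [mul_sub]
    rw [integral_sub hφint hTint, hT0, sub_zero, ← integral_smul]
    refine integral_congr_ae (ae_of_all _ fun y => ?_)
    simp only [dilate_apply, hzh, Complex.real_smul]
    ring
  rw [e1, norm_smul, Real.norm_of_nonneg (by positivity), mul_assoc]
  refine mul_le_mul_of_nonneg_left ?_ (by positivity)
  rw [← integral_const_mul]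
  refine norm_integral_le_of_norm_le (ha.norm.const_mul _) ?_
  filter_upwards [hsupp] with y hy
  by_cases hyc : y ∈ cube x₀ r
  · rw [norm_mul, mul_comm]
    gcongr
    refine (norm_sub_taylor_le hd hφ z (h y)).trans ?_
    gcongr
    calc ∑ i, |h y i| ≤ ∑ _i : Fin n, r / (2 * t) := Finset.sum_le_sum fun i _ => by
          simp only [hh, PiLp.smul_apply, PiLp.sub_apply, smul_eq_mul]
          rw [abs_mul, abs_of_pos (inv_pos.2 ht), abs_sub_comm, inv_mul_eq_div,
            show r / (2 * t) = (r / 2) / t by field_simp]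
          gcongr
          exact hyc i
      _ = n * (r / (2 * t)) := by simp
  · simp [hy hyc]

end Dilate

/-! ### The local grand maximal function of a function -/

section MaximalFunction

variable {n : ℕ} {w : E n → ℝ} {r : ℝ} {A : ℝ≥0∞}

/-- The local grand maximal function of a locally integrable function. -/
noncomputable def maxFn (N : ℕ) (a : E n → ℂ) (x : E n) : ℝ≥0∞ :=
  ⨆ (t : ℝ) (ht : 0 < t) (_ : t < 1) (φ ∈ testClass (n := n) N), ‖∫ y, a y * dilate φ t ht x y‖ₑ

theorem maxFn_le {N : ℕ} {a : E n → ℂ} {x : E n} {b : ℝ≥0∞}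
    (h : ∀ (t : ℝ) (ht : 0 < t), t < 1 → ∀ φ ∈ testClass (n := n) N,
      ‖∫ y, a y * dilate φ t ht x y‖ₑ ≤ b) : maxFn N a x ≤ b :=
  iSup_le fun t => iSup_le fun ht => iSup_le fun ht1 => iSup₂_le fun φ hφ => h t ht ht1 φ hφ

theorem le_maxFn {N : ℕ} (a : E n → ℂ) (x : E n) {t : ℝ} (ht : 0 < t) (ht1 : t < 1) {φ : Test n}
    (hφ : φ ∈ testClass N) : ‖∫ y, a y * dilate φ t ht x y‖ₑ ≤ maxFn N a x :=
  le_iSup_of_le t (le_iSup_of_le ht (le_iSup_of_le ht1 (le_iSup₂_of_le φ hφ le_rfl)))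

theorem exists_of_lt_maxFn {N : ℕ} {a : E n → ℂ} {x : E n} {b : ℝ≥0∞} (h : b < maxFn N a x) :
    ∃ (t : ℝ) (ht : 0 < t), t < 1 ∧ ∃ φ ∈ testClass (n := n) N,
      b < ‖∫ y, a y * dilate φ t ht x y‖ₑ := by
  by_contra! hcon
  exact absurd (maxFn_le hcon) (not_le.2 h)

/-- The supremum is uncountable, but each term is the norm of a continuous convolution, so the
supremum is lower semicontinuous. -/
theorem measurable_maxFn (N : ℕ) {a : E n → ℂ} (ha : LocallyIntegrable a) :
    Measurable (maxFn N a) := by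
  refine LowerSemicontinuous.measurable ?_
  unfold maxFn
  refine lowerSemicontinuous_iSup fun t => lowerSemicontinuous_iSup fun ht =>
    lowerSemicontinuous_iSup fun _ => lowerSemicontinuous_iSup fun φ =>
    lowerSemicontinuous_iSup fun _ => Continuous.lowerSemicontinuous ?_
  have hcs : HasCompactSupport fun z => dilate φ t ht 0 (-z) :=
    (dilate φ t ht 0).hasCompactSupport.comp_homeomorph (Homeomorph.neg (E n))
  have hcont : Continuous fun z => dilate φ t ht 0 (-z) :=
    (dilate φ t ht 0).continuous.comp continuous_neg
  have H := hcs.continuous_convolution_right (ContinuousLinearMap.mul ℝ ℂ) (μ := volume) ha hcont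
  refine (H.congr fun x => ?_).enorm
  simp only [convolution, ContinuousLinearMap.mul_apply']
  refine integral_congr_ae (ae_of_all _ fun y => ?_)
  simp [dilate_apply]

theorem maxFn_congr {N : ℕ} {a b : E n → ℂ} (h : a =ᵐ[volume] b) (x : E n) :
    maxFn N a x = maxFn N b x := by
  have : ∀ (t : ℝ) (ht : 0 < t) (φ : Test n), ∫ y, a y * dilate φ t ht x y =
      ∫ y, b y * dilate φ t ht x y := fun t ht φ => by
    refine integral_congr_ae ?_
    filter_upwards [h] with y hy
    rw [hy]
  simp only [maxFn, this]

theorem maxFn_eq_zero {N : ℕ} {a : E n → ℂ} {x₀ x : E n} {l : ℝ}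
    (hsupp : ∀ᵐ x, x ∉ cube x₀ l → a x = 0) (hx : x ∉ cube x₀ (l + 2)) : maxFn N a x = 0 := by
  refine le_antisymm (maxFn_le fun t ht ht1 φ hφ => ?_) zero_le
  rw [mem_cube] at hx
  push Not at hx
  obtain ⟨i, hi⟩ := hx
  rw [integral_eq_zero_of_ae, enorm_zero]
  filter_upwards [hsupp] with y hy
  by_cases hyc : y ∈ cube x₀ l
  · rw [dilate_eq_zero hφ ht (i := i)]
    · simp
    · have := abs_sub_le (x i) (y i) (x₀ i)
      linarith [hyc i]
  · simp [hy hyc]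

theorem AvgBound.locallyIntegrable (hA : AvgBound r A w) (hw : IsWeight w) (hr : 0 < r)
    (hAt : A < ∞) {a : E n → ℂ} (ha : AEStronglyMeasurable a)
    (hfin : ∫⁻ x, ‖a x‖ₑ ^ r ∂(wMeasure w) < ∞) : LocallyIntegrable a := by
  intro x
  refine ⟨cube x 1, mem_interior_iff_mem_nhds.1 (mem_interior.2 ⟨Metric.ball x (1 / 2), ?_,
    Metric.isOpen_ball, by simp⟩), ha.restrict, ?_⟩
  · intro y hy i
    rw [Metric.mem_ball, dist_eq_norm] at hy
    exact ((PiLp.norm_apply_le (y - x) i).trans hy.le)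
  · have h := hA x 1 one_pos le_rfl (fun y => ‖a y‖ₑ) ha.enorm
    rw [hasFiniteIntegral_iff_enorm]
    have h1 : wMeasure w (cube x 1) ^ (1 / r) ≠ 0 := by
      simp [ENNReal.rpow_eq_zero_iff, (wMeasure_cube_pos hw x one_pos).ne',
        (wMeasure_cube_lt_top hw x 1).ne]
    refine lt_of_le_of_lt ((ENNReal.le_div_iff_mul_le (Or.inl h1) (Or.inl
      (ENNReal.rpow_ne_top_of_nonneg (by positivity) (wMeasure_cube_lt_top hw x 1).ne))).2 h) ?_
    refine ENNReal.div_lt_top (ENNReal.mul_ne_top (ENNReal.mul_ne_top hAt.ne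
      (volume_cube_lt_top x 1).ne) (ENNReal.rpow_ne_top_of_nonneg (by positivity) ?_)) h1
    exact ((setLIntegral_le_lintegral _ _).trans_lt hfin).ne

/-- The weak type bound for the local grand maximal function. -/
theorem AvgBound.exists_weak (hA : AvgBound r A w) (hr : 0 < r) (hAt : A < ∞) (N : ℕ) :
    ∃ C : ℝ≥0∞, C < ∞ ∧ ∀ a : E n → ℂ, AEStronglyMeasurable a → ∀ l : ℝ≥0∞, l ≠ 0 → l ≠ ∞ →
      wMeasure w {x | l < maxFn N a x} ≤
        C * (l⁻¹ ^ r * ∫⁻ x, ‖a x‖ₑ ^ r ∂(wMeasure w)) := by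
  obtain ⟨C, hC, hV⟩ := hA.exists_vitali hr hAt 2
  set B : ℝ≥0∞ := (boxIndex n 2).card * A with hB
  have hBt : B < ∞ := ENNReal.mul_lt_top (ENNReal.natCast_lt_top _) hAt
  refine ⟨C * B ^ r, ENNReal.mul_lt_top hC (ENNReal.rpow_lt_top_of_nonneg hr.le hBt.ne),
    fun a ha l hl hl' => ?_⟩
  -- The total mass of `ν` is the desired bound; each point of the level set needs a nearby cube
  -- with `w(Q) ≤ ν(Q)`.
  set ν : Measure (E n) := (B ^ r * l⁻¹ ^ r) •
    (wMeasure w).withDensity (fun x => ‖a x‖ₑ ^ r) with hν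
  refine (hV ν {x | l < maxFn N a x} fun x hx => ?_).trans (le_of_eq ?_)
  swap
  · rw [hν, Measure.smul_apply, withDensity_apply _ MeasurableSet.univ, Measure.restrict_univ,
      smul_eq_mul]
    ring
  obtain ⟨t, ht, ht1, φ, hφ, hlt⟩ := exists_of_lt_maxFn hx
  have h1 : l * ENNReal.ofReal t ^ n ≤ ∫⁻ y in cube x (2 * t), ‖a y‖ₑ := by
    have := hlt.le.trans (enorm_integral_dilate_le hφ ht a x)
    rwa [← ENNReal.div_eq_inv_mul,
      ENNReal.le_div_iff_mul_le (Or.inl (by positivity)) (Or.inl (by finiteness))] at this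
  -- The cube of side `2t` may be too large for the averaging inequality. It is covered by cubes of
  -- side `t/2 ≤ 1/2`, of which the one with the largest integral of `|a|` is kept.
  set s := t / 2 with hs
  have hs0 : 0 < s := by positivity
  have hne : (boxIndex n 2).Nonempty := ⟨0, by simp [boxIndex]⟩
  obtain ⟨k, hk, hmax⟩ := (boxIndex n 2).exists_max_image
    (fun k => ∫⁻ y in cube (x + latticePoint s k) s, ‖a y‖ₑ) hne
  set z := x + latticePoint s k with hz
  have h2 : ∫⁻ y in cube x (2 * t), ‖a y‖ₑ ≤
      (boxIndex n 2).card * ∫⁻ y in cube z s, ‖a y‖ₑ := by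
    have hsub := cube_subset_iUnion_lattice x 2 hs0
    rw [show 2 * ((2 : ℕ) : ℝ) * s = 2 * t by rw [hs]; push_cast; ring] at hsub
    rw [← withDensity_apply _ (measurableSet_cube _ _), ← nsmul_eq_mul]
    refine (measure_mono hsub).trans ((measure_biUnion_finset_le _ _).trans
      (Finset.sum_le_card_nsmul _ _ _ fun j hj => ?_))
    rw [withDensity_apply _ (measurableSet_cube _ _)]
    exact hmax j hj
  refine ⟨z, s, hs0, by linarith, fun i => ?_, ?_⟩
  · have hki := Finset.mem_Icc.1 (Fintype.mem_piFinset.1 hk i)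
    have hki' : |(k i : ℝ)| ≤ 2 := abs_le.2 ⟨by exact_mod_cast hki.1, by exact_mod_cast hki.2⟩
    simp only [hz, latticePoint, PiLp.add_apply, sub_add_cancel_left]
    rw [abs_neg, abs_mul, abs_of_pos hs0, mul_comm]
    push_cast
    gcongr
  · have h3 := hA z s hs0 (by linarith) (fun y => ‖a y‖ₑ) ha.enorm
    rw [volume_cube] at h3
    set J := ∫⁻ y in cube z s, ‖a y‖ₑ ^ r ∂(wMeasure w) with hJ
    have h4 : l * wMeasure w (cube z s) ^ (1 / r) ≤ B * J ^ (1 / r) := by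
      have ht0 : ENNReal.ofReal t ^ n ≠ 0 := by positivity
      rw [← ENNReal.mul_le_mul_iff_right ht0 (by finiteness)]
      calc ENNReal.ofReal t ^ n * (l * wMeasure w (cube z s) ^ (1 / r))
          = (l * ENNReal.ofReal t ^ n) * wMeasure w (cube z s) ^ (1 / r) := by ring
        _ ≤ ((boxIndex n 2).card * ∫⁻ y in cube z s, ‖a y‖ₑ) * wMeasure w (cube z s) ^ (1 / r) := by
            exact mul_le_mul_left (h1.trans h2) _
        _ = (boxIndex n 2).card *
            ((∫⁻ y in cube z s, ‖a y‖ₑ) * wMeasure w (cube z s) ^ (1 / r)) := by ring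
        _ ≤ (boxIndex n 2).card * (A * ENNReal.ofReal s ^ n * J ^ (1 / r)) := by gcongr
        _ ≤ (boxIndex n 2).card * (A * ENNReal.ofReal t ^ n * J ^ (1 / r)) := by
            gcongr
            linarith
        _ = _ := by rw [hB]; ring
    have h5 := ENNReal.rpow_le_rpow h4 hr.le
    rw [ENNReal.mul_rpow_of_nonneg _ _ hr.le, ENNReal.mul_rpow_of_nonneg _ _ hr.le,
      ← ENNReal.rpow_mul, ← ENNReal.rpow_mul, one_div_mul_cancel hr.ne', ENNReal.rpow_one,
      ENNReal.rpow_one] at h5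
    rw [hν, Measure.smul_apply, withDensity_apply _ (measurableSet_cube z s), smul_eq_mul, ← hJ]
    calc wMeasure w (cube z s) = (l⁻¹ * l) ^ r * wMeasure w (cube z s) := by
          rw [ENNReal.inv_mul_cancel hl hl', ENNReal.one_rpow, one_mul]
      _ = l⁻¹ ^ r * (l ^ r * wMeasure w (cube z s)) := by
          rw [ENNReal.mul_rpow_of_nonneg _ _ hr.le, mul_assoc]
      _ ≤ l⁻¹ ^ r * (B ^ r * J) := by gcongr
      _ = _ := by ring

theorem AvgBound.exists_lintegral_maxFn_le (hA : AvgBound r A w) (hw : IsWeight w) (hAt : A < ∞)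
    {p : ℝ} (hp : 0 < p) (hpr : p < r) (N : ℕ) {D : ℝ≥0∞} (hD : D < ∞) :
    ∃ C : ℝ≥0∞, C < ∞ ∧ ∀ (a : E n → ℂ) (S : Set (E n)) (m : ℝ≥0∞), AEStronglyMeasurable a →
      m ≠ 0 → m ≠ ∞ → eLpNorm a (ENNReal.ofReal r) (wMeasure w) ≤ m ^ (1 / r - 1 / p) →
      wMeasure w S ≤ D * m → ∫⁻ x in S, maxFn N a x ^ p ∂(wMeasure w) ≤ C := by
  have hr : 0 < r := hp.trans hpr
  obtain ⟨C₁, hC₁, hweak⟩ := hA.exists_weak hr hAt N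
  obtain ⟨C₂, hC₂, hkol⟩ := exists_lintegral_rpow_le_of_weak hp hpr
  refine ⟨C₂ * (C₁ + D), ENNReal.mul_lt_top hC₂ (ENNReal.add_lt_top.2 ⟨hC₁, hD⟩),
    fun a S m ha hm hm' hnorm hS => ?_⟩
  have hI : ∫⁻ x, ‖a x‖ₑ ^ r ∂(wMeasure w) ≤ m ^ (1 - r / p) := by
    rw [eLpNorm_eq_lintegral_rpow_enorm_toReal (by simpa using hr) ENNReal.ofReal_ne_top,
      ENNReal.toReal_ofReal hr.le] at hnorm
    have := ENNReal.rpow_le_rpow hnorm hr.le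
    rw [← ENNReal.rpow_mul, one_div_mul_cancel hr.ne', ENNReal.rpow_one, ← ENNReal.rpow_mul] at this
    convert this using 2
    field_simp
  have hIt : ∫⁻ x, ‖a x‖ₑ ^ r ∂(wMeasure w) < ∞ :=
    hI.trans_lt (by simp [lt_top_iff_ne_top, ENNReal.rpow_eq_top_iff, hm, hm'])
  -- The natural height of an atom on a set of measure `m`: it makes `l ^ p * m = 1`.
  set l : ℝ≥0∞ := m ^ (-(1 / p)) with hl
  have hl0 : l ≠ 0 := by simp [hl, ENNReal.rpow_eq_zero_iff, hm, hm']
  have hlt : l ≠ ∞ := by simp [hl, ENNReal.rpow_eq_top_iff, hm, hm']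
  have H := hkol (wMeasure w) (maxFn N a) S ((C₁ + D) * m) l
    (measurable_maxFn N (hA.locallyIntegrable hw hr hAt ha hIt))
    (hS.trans (by gcongr; exact le_add_self)) hl0 hlt fun k => ?_
  · refine H.trans (le_of_eq ?_)
    have : l ^ p * m = 1 := by
      rw [hl, ← ENNReal.rpow_mul, neg_mul, one_div_mul_cancel hp.ne', ENNReal.rpow_neg_one,
        ENNReal.inv_mul_cancel hm hm']
    calc C₂ * (l ^ p * ((C₁ + D) * m)) = C₂ * (C₁ + D) * (l ^ p * m) := by ring
      _ = _ := by rw [this, mul_one]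
  · refine (hweak a ha (2 ^ k * l) (mul_ne_zero (by positivity) hl0)
      (ENNReal.mul_ne_top (by finiteness) hlt)).trans ?_
    have e1 : (2 ^ k * l)⁻¹ ^ r = ENNReal.ofReal (2 ^ (-r)) ^ k * m ^ (r / p) := by
      rw [ENNReal.mul_inv (Or.inl (by positivity)) (Or.inl (by finiteness)),
        ENNReal.mul_rpow_of_nonneg _ _ hr.le]
      congr 1
      · rw [ENNReal.inv_rpow, ← ENNReal.rpow_neg, ← ENNReal.rpow_natCast 2 k, ← ENNReal.rpow_mul,
          mul_comm, ENNReal.rpow_mul, ENNReal.rpow_natCast,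
          ← ENNReal.ofReal_rpow_of_pos two_pos, ENNReal.ofReal_ofNat]
      · rw [hl, ← ENNReal.rpow_neg, ← ENNReal.rpow_mul]
        congr 1
        ring
    rw [e1]
    calc C₁ * (ENNReal.ofReal (2 ^ (-r)) ^ k * m ^ (r / p) *
          ∫⁻ x, ‖a x‖ₑ ^ r ∂(wMeasure w))
        ≤ C₁ * (ENNReal.ofReal (2 ^ (-r)) ^ k * m ^ (r / p) * m ^ (1 - r / p)) := by gcongr
      _ = C₁ * m * ENNReal.ofReal (2 ^ (-r)) ^ k := by
          rw [mul_assoc (_ ^ k), ← ENNReal.rpow_add _ _ hm hm', add_sub_cancel, ENNReal.rpow_one]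
          ring
      _ ≤ _ := by gcongr; exact le_self_add

end MaximalFunction

/-! ### Uniform bounds for atoms -/

section Atoms

variable {n : ℕ} {w : E n → ℝ} {r : ℝ} {A : ℝ≥0∞}

/-- Hölder on the support lowers `q`, possibly `∞`, to the finite exponent `r` while keeping the
atomic normalisation. -/
theorem eLpNorm_le_of_support {p : ℝ} {q : ℝ≥0∞} (hr : 0 < r) (hrq : ENNReal.ofReal r ≤ q)
    {a : E n → ℂ} (ha : AEStronglyMeasurable a) {S : Set (E n)} (hS : MeasurableSet S)
    (hsupp : ∀ᵐ x, x ∉ S → a x = 0) (hS0 : wMeasure w S ≠ 0) (hSt : wMeasure w S ≠ ∞)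
    (hnorm : eLpNorm a q (wMeasure w) ≤ wMeasure w S ^ (q⁻¹.toReal - 1 / p)) :
    eLpNorm a (ENNReal.ofReal r) (wMeasure w) ≤ wMeasure w S ^ (1 / r - 1 / p) := by
  have hac := wMeasure_absolutelyContinuous w
  have hind : a =ᵐ[wMeasure w] S.indicator a := by
    refine hac.ae_le ?_
    filter_upwards [hsupp] with x hx
    by_cases h : x ∈ S
    · rw [Set.indicator_of_mem h]
    · rw [Set.indicator_of_notMem h, hx h]
  rw [eLpNorm_congr_ae hind, eLpNorm_indicator_eq_eLpNorm_restrict hS] at hnorm ⊢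
  refine (eLpNorm_le_eLpNorm_mul_rpow_measure_univ hrq (ha.mono_ac hac).restrict).trans ?_
  rw [Measure.restrict_apply_univ, ENNReal.toReal_ofReal hr.le]
  calc _ ≤ wMeasure w S ^ (q⁻¹.toReal - 1 / p) * wMeasure w S ^ (1 / r - 1 / q.toReal) := by
        gcongr
    _ = _ := by
        rw [← ENNReal.rpow_add _ _ hS0 hSt, ENNReal.toReal_inv]
        congr 1
        ring

theorem AvgBound.lintegral_enorm_le (hA : AvgBound r A w) (hw : IsWeight w) {p : ℝ} (hr : 0 < r)
    {a : E n → ℂ} (ha : AEStronglyMeasurable a) {x₀ : E n} {l : ℝ} (hl : 0 < l) (hl1 : l ≤ 1)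
    (hsupp : ∀ᵐ x, x ∉ cube x₀ l → a x = 0)
    (hnorm : eLpNorm a (ENNReal.ofReal r) (wMeasure w) ≤
      wMeasure w (cube x₀ l) ^ (1 / r - 1 / p)) :
    ∫⁻ x, ‖a x‖ₑ ≤ A * ENNReal.ofReal l ^ n * wMeasure w (cube x₀ l) ^ (-(1 / p)) := by
  have hm := (wMeasure_cube_pos hw x₀ hl).ne'
  have hm' := (wMeasure_cube_lt_top hw x₀ l).ne
  set m := wMeasure w (cube x₀ l) with hmdef
  have h1 : ∫⁻ x, ‖a x‖ₑ = ∫⁻ x in cube x₀ l, ‖a x‖ₑ := by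
    rw [← lintegral_indicator (measurableSet_cube x₀ l)]
    refine lintegral_congr_ae ?_
    filter_upwards [hsupp] with x hx
    by_cases h : x ∈ cube x₀ l
    · rw [Set.indicator_of_mem h]
    · rw [Set.indicator_of_notMem h, hx h, enorm_zero]
  have h2 := hA x₀ l hl hl1 (fun y => ‖a y‖ₑ) ha.enorm
  rw [eLpNorm_eq_lintegral_rpow_enorm_toReal (by simpa using hr) ENNReal.ofReal_ne_top,
    ENNReal.toReal_ofReal hr.le] at hnorm
  rw [← h1, volume_cube, ← hmdef] at h2
  have h3 : m ^ (1 / r) ≠ 0 := by simp [ENNReal.rpow_eq_zero_iff, hm, hm']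
  have h4 : m ^ (1 / r) ≠ ∞ := by simp [ENNReal.rpow_eq_top_iff, hm, hm']
  rw [← ENNReal.mul_le_mul_iff_left h3 h4]
  refine h2.trans ?_
  rw [mul_assoc _ (m ^ (-(1 / p))), ← ENNReal.rpow_add _ _ hm hm']
  gcongr
  refine le_trans ?_ (hnorm.trans (le_of_eq ?_))
  · gcongr
    exact Measure.restrict_le_self
  · congr 1
    ring

theorem maxFn_le_of_moments {N d k : ℕ} (hd : d ≤ N) (hk : 1 ≤ k) {a : E n → ℂ} {x₀ x : E n}
    {l : ℝ} (hl : 0 < l) (hl1 : l < 1) (ha : Integrable a)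
    (hsupp : ∀ᵐ x, x ∉ cube x₀ l → a x = 0)
    (hmom : ∀ α : Fin n → ℕ, ∑ i, α i ≤ d → ∫ x, a x * ((∏ i, x i ^ α i : ℝ) : ℂ) = 0)
    (hx : x ∉ cube x₀ (2 ^ k * l)) :
    maxFn N a x ≤ (cube x₀ 4).indicator (fun _ => ENNReal.ofReal (4 ^ n * (2 * n) ^ (d + 1) *
      ((2 ^ (n + d + 1))⁻¹) ^ k * (l ^ n)⁻¹) * ∫⁻ y, ‖a y‖ₑ) x := by
  refine maxFn_le fun t ht ht1 φ hφ => ?_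
  -- A nonzero pairing forces both: `|xᵢ - x₀ᵢ| < t + l/2 < 2` for every `i`, and `t > (2^k - 1) l /
  -- 2 ≥ 2^k l / 4` as `k ≥ 1`. The moment bound decreases in `t`, so it is evaluated at `2^k l /
  -- 4`.
  by_cases hcase : x ∈ cube x₀ 4 ∧ 2 ^ k * l / 4 < t
  · obtain ⟨hx4, htk⟩ := hcase
    rw [Set.indicator_of_mem hx4, ← ofReal_norm, ← ofReal_integral_norm_eq_lintegral_enorm ha,
      ← ENNReal.ofReal_mul (by positivity)]
    refine ENNReal.ofReal_le_ofReal
      ((norm_integral_dilate_le_of_moments hd hφ ha hsupp hmom ht x).trans ?_)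
    refine mul_le_mul_of_nonneg_right ?_ (integral_nonneg fun _ => norm_nonneg _)
    calc (t ^ n)⁻¹ * (n * (l / (2 * t))) ^ (d + 1)
        ≤ ((2 ^ k * l / 4) ^ n)⁻¹ * (n * (l / (2 * (2 ^ k * l / 4)))) ^ (d + 1) := by gcongr
      _ = _ := by
          have : (n : ℝ) * (l / (2 * (2 ^ k * l / 4))) = 2 * n * (2 ^ k)⁻¹ := by
            field_simp
            norm_num
          have hpow : (((2 : ℝ) ^ (n + d + 1))⁻¹) ^ k =
              ((2 ^ k) ^ n)⁻¹ * ((2 ^ k)⁻¹) ^ (d + 1) := by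
            rw [inv_pow, inv_pow, ← mul_inv, ← pow_add, ← pow_mul, ← pow_mul]
            ring_nf
          rw [this, div_pow, mul_pow, mul_pow, hpow]
          field_simp
  · rw [integral_eq_zero_of_ae, enorm_zero]
    · exact zero_le
    rw [mem_cube] at hx
    push Not at hx
    obtain ⟨i, hi⟩ := hx
    have hk2 : (2 : ℝ) ≤ 2 ^ k := by
      calc (2 : ℝ) = 2 ^ 1 := by norm_num
        _ ≤ 2 ^ k := pow_le_pow_right₀ one_le_two hk
    filter_upwards [hsupp] with y hy
    by_cases hyc : y ∈ cube x₀ l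
    swap
    · simp [hy hyc]
    by_contra hne
    have hlt : ∀ j, |x j - y j| < t := fun j => by
      by_contra! hj
      exact hne (by rw [dilate_eq_zero hφ ht hj]; simp)
    refine hcase ⟨fun j => ?_, ?_⟩
    · have := abs_sub_le (x j) (y j) (x₀ j)
      linarith [hyc j, hlt j]
    · have := abs_sub_le (x i) (y i) (x₀ i)
      have h1 := hyc i
      have h2 := hlt i
      nlinarith

theorem exists_mem_cube_two_pow {x₀ x : E n} {l : ℝ} (hl : 0 < l) (hx : x ∉ cube x₀ (2 * l)) :
    ∃ k : ℕ, 1 ≤ k ∧ x ∈ cube x₀ (2 ^ (k + 1) * l) ∧ x ∉ cube x₀ (2 ^ k * l) := by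
  have hex : ∃ k : ℕ, x ∈ cube x₀ (2 ^ k * l) := by
    obtain ⟨k, hk⟩ := pow_unbounded_of_one_lt (2 * ‖x - x₀‖ / l) one_lt_two
    refine ⟨k, fun i => ?_⟩
    rw [div_lt_iff₀ hl] at hk
    have := PiLp.norm_apply_le (x - x₀) i
    rw [Real.norm_eq_abs, PiLp.sub_apply] at this
    linarith
  classical
  have h2 : 2 ≤ Nat.find hex := by
    by_contra! hlt
    refine hx (cube_mono x₀ ?_ (Nat.find_spec hex))
    have : (2 : ℝ) ^ Nat.find hex ≤ 2 ^ 1 := pow_le_pow_right₀ one_le_two (by omega)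
    nlinarith
  refine ⟨Nat.find hex - 1, by omega, ?_, Nat.find_min hex (by omega)⟩
  rw [Nat.sub_add_cancel (by omega)]
  exact Nat.find_spec hex

theorem AvgBound.exists_lintegral_compl_le (hA : AvgBound r A w) (hw : IsWeight w) (hAt : A < ∞)
    (hr : 0 < r) {p : ℝ} (hp : 0 < p) {N d : ℕ} (hd : d ≤ N) (hrd : n * r < p * (n + d + 1)) :
    ∃ C : ℝ≥0∞, C < ∞ ∧ ∀ (a : E n → ℂ) (x₀ : E n) (l : ℝ), 0 < l → l < 1 →
      AEStronglyMeasurable a → (∀ᵐ x, x ∉ cube x₀ l → a x = 0) →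
      eLpNorm a (ENNReal.ofReal r) (wMeasure w) ≤ wMeasure w (cube x₀ l) ^ (1 / r - 1 / p) →
      (∀ α : Fin n → ℕ, ∑ i, α i ≤ d → ∫ x, a x * ((∏ i, x i ^ α i : ℝ) : ℂ) = 0) →
      ∫⁻ x in (cube x₀ (2 * l))ᶜ, maxFn N a x ^ p ∂(wMeasure w) ≤ C := by
  obtain ⟨G, hG, hgrow⟩ := hA.exists_growth hr hAt
  obtain ⟨κ, hκ⟩ : ∃ κ : ℝ, 4 ^ n * (2 * n) ^ (d + 1) = κ := ⟨_, rfl⟩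
  obtain ⟨β, hβ⟩ : ∃ β : ℝ, (2 ^ (n + d + 1))⁻¹ = β := ⟨_, rfl⟩
  have hκ0 : 0 ≤ κ := by rw [← hκ]; positivity
  have hβ0 : 0 < β := by rw [← hβ]; positivity
  set ρ : ℝ≥0∞ := ENNReal.ofReal (β ^ p * 2 ^ (n * r)) with hρ
  -- `ρ = 2^{nr - p(n+d+1)}`: decay of the maximal function against growth of the weight.
  have hρ1 : ρ < 1 := by
    rw [hρ, ENNReal.ofReal_lt_one, ← hβ, ← Real.rpow_natCast, ← Real.rpow_neg two_pos.le,
      ← Real.rpow_mul two_pos.le, ← Real.rpow_add two_pos]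
    refine Real.rpow_lt_one_of_one_lt_of_neg one_lt_two ?_
    push_cast
    linarith
  set B : ℝ≥0∞ := (ENNReal.ofReal κ * A) ^ p * (G * ENNReal.ofReal (2 ^ (n * r))) with hB
  have hBt : B < ∞ := ENNReal.mul_lt_top
    (ENNReal.rpow_lt_top_of_nonneg hp.le (ENNReal.mul_ne_top ENNReal.ofReal_ne_top hAt.ne))
    (ENNReal.mul_lt_top hG ENNReal.ofReal_lt_top)
  refine ⟨B * ∑' k : ℕ, ρ ^ k, ?_, ?_⟩
  · rw [ENNReal.tsum_geometric]
    exact ENNReal.mul_lt_top hBt (ENNReal.inv_lt_top.2 (tsub_pos_of_lt hρ1))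
  intro a x₀ l hl hl1 ha hsupp hnorm hmom
  have hm := (wMeasure_cube_pos hw x₀ hl).ne'
  have hm' := (wMeasure_cube_lt_top hw x₀ l).ne
  have hL := hA.lintegral_enorm_le hw hr ha hl hl1.le hsupp hnorm
  set m := wMeasure w (cube x₀ l) with hmdef
  have h_int : Integrable a := ⟨ha, by
    rw [hasFiniteIntegral_iff_enorm]
    refine hL.trans_lt (ENNReal.mul_lt_top (ENNReal.mul_lt_top hAt (by finiteness)) ?_)
    simp [lt_top_iff_ne_top, ENNReal.rpow_eq_top_iff, hm, hm']⟩
  have hpt : ∀ x ∈ (cube x₀ (2 * l))ᶜ, maxFn N a x ^ p ≤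
      -- Truncation at side `4` loses nothing, because the maximal function vanishes beyond it, and
      -- stays in the range where the growth bound holds.
      ∑' k : ℕ, (cube x₀ (min (2 ^ (k + 1) * l) 4)).indicator
        (fun _ => (ENNReal.ofReal κ * A) ^ p * ENNReal.ofReal (β ^ p) ^ k * m⁻¹) x := by
    intro x hx
    obtain ⟨k, hk1, hk2, hk3⟩ := exists_mem_cube_two_pow hl hx
    refine le_trans ?_ (ENNReal.le_tsum k)
    have h1 := maxFn_le_of_moments hd hk1 hl hl1 h_int hsupp hmom hk3
    rw [hκ, hβ] at h1
    by_cases hx4 : x ∈ cube x₀ 4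
    · have hmem : x ∈ cube x₀ (min (2 ^ (k + 1) * l) 4) := by
        rcases min_choice ((2 : ℝ) ^ (k + 1) * l) 4 with h | h <;> rw [h] <;> assumption
      rw [Set.indicator_of_mem hx4] at h1
      rw [Set.indicator_of_mem hmem]
      have h2 : maxFn N a x ≤
          ENNReal.ofReal κ * A * ENNReal.ofReal β ^ k * m ^ (-(1 / p)) := by
        refine h1.trans ((mul_le_mul_right hL _).trans (le_of_eq ?_))
        have hln : ENNReal.ofReal l ^ n ≠ 0 := by positivity
        rw [ENNReal.ofReal_mul (by positivity), ENNReal.ofReal_mul (by positivity),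
          ENNReal.ofReal_pow hβ0.le, ENNReal.ofReal_inv_of_pos (by positivity),
          ENNReal.ofReal_pow hl.le]
        calc ENNReal.ofReal κ * ENNReal.ofReal β ^ k * (ENNReal.ofReal l ^ n)⁻¹ *
              (A * ENNReal.ofReal l ^ n * m ^ (-(1 / p)))
            = ENNReal.ofReal κ * A * ENNReal.ofReal β ^ k * m ^ (-(1 / p)) *
              ((ENNReal.ofReal l ^ n)⁻¹ * ENNReal.ofReal l ^ n) := by ring
          _ = _ := by rw [ENNReal.inv_mul_cancel hln (by finiteness), mul_one]
      refine (ENNReal.rpow_le_rpow h2 hp.le).trans (le_of_eq ?_)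
      rw [ENNReal.mul_rpow_of_nonneg _ _ hp.le, ENNReal.mul_rpow_of_nonneg _ _ hp.le,
        ← ENNReal.rpow_mul m, neg_mul, one_div_mul_cancel hp.ne', ENNReal.rpow_neg_one,
        ← ENNReal.ofReal_rpow_of_pos hβ0, ← ENNReal.rpow_natCast, ← ENNReal.rpow_natCast,
        ← ENNReal.rpow_mul, ← ENNReal.rpow_mul, mul_comm p]
    · rw [Set.indicator_of_notMem hx4] at h1
      rw [le_antisymm h1 zero_le, ENNReal.zero_rpow_of_pos hp]
      exact zero_le
  calc ∫⁻ x in (cube x₀ (2 * l))ᶜ, maxFn N a x ^ p ∂(wMeasure w)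
      ≤ ∫⁻ x in (cube x₀ (2 * l))ᶜ, ∑' k : ℕ, (cube x₀ (min (2 ^ (k + 1) * l) 4)).indicator
        (fun _ => (ENNReal.ofReal κ * A) ^ p * ENNReal.ofReal (β ^ p) ^ k * m⁻¹) x
          ∂(wMeasure w) := setLIntegral_mono' (measurableSet_cube _ _).compl hpt
    _ ≤ ∫⁻ x, ∑' k : ℕ, (cube x₀ (min (2 ^ (k + 1) * l) 4)).indicator
        (fun _ => (ENNReal.ofReal κ * A) ^ p * ENNReal.ofReal (β ^ p) ^ k * m⁻¹) x
          ∂(wMeasure w) := setLIntegral_le_lintegral _ _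
    _ = ∑' k : ℕ, (ENNReal.ofReal κ * A) ^ p * ENNReal.ofReal (β ^ p) ^ k * m⁻¹ *
          wMeasure w (cube x₀ (min (2 ^ (k + 1) * l) 4)) := by
        rw [lintegral_tsum fun k =>
          (measurable_const.indicator (measurableSet_cube _ _)).aemeasurable]
        simp_rw [lintegral_indicator_const (measurableSet_cube _ _)]
    _ ≤ ∑' k : ℕ, B * ρ ^ k := by
        refine ENNReal.tsum_le_tsum fun k => ?_
        have hle : l ≤ min (2 ^ (k + 1) * l) 4 :=
          le_min (le_mul_of_one_le_left hl.le (one_le_pow₀ one_le_two)) (by linarith)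
        have h1 : wMeasure w (cube x₀ (min (2 ^ (k + 1) * l) 4)) ≤
            G * ENNReal.ofReal (2 ^ (n * r) * (2 ^ (n * r)) ^ k) * m := by
          refine (hgrow x₀ l _ hl hle (min_le_right _ _)).trans ?_
          gcongr
          calc (min (2 ^ (k + 1) * l) 4 / l) ^ (n * r)
              ≤ ((2 : ℝ) ^ (k + 1)) ^ (n * r) := by
                refine Real.rpow_le_rpow (div_nonneg (hl.le.trans hle) hl.le) ?_ (by positivity)
                rw [div_le_iff₀ hl]
                exact min_le_left _ _
            _ = _ := by
                rw [← Real.rpow_natCast, ← Real.rpow_mul two_pos.le, mul_comm,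
                  Real.rpow_mul two_pos.le, Real.rpow_natCast, pow_succ']
        refine (mul_le_mul_right h1 _).trans (le_of_eq ?_)
        rw [hρ, ENNReal.ofReal_mul (p := 2 ^ (n * r)) (by positivity),
          ENNReal.ofReal_mul (p := β ^ p) (by positivity), mul_pow,
          ENNReal.ofReal_pow (by positivity), hB]
        calc _ = (ENNReal.ofReal κ * A) ^ p * (G * ENNReal.ofReal (2 ^ (n * r))) *
              (ENNReal.ofReal (β ^ p) ^ k * ENNReal.ofReal (2 ^ (n * r)) ^ k) * (m⁻¹ * m) := by ring
          _ = _ := by rw [ENNReal.inv_mul_cancel hm hm', mul_one]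
    _ = _ := ENNReal.tsum_mul_left

theorem lintegral_rpow_ne_top_of_eLpNorm {p : ℝ} (hr : 0 < r) {a : E n → ℂ} {m : ℝ≥0∞}
    (hm : m ≠ 0) (hm' : m ≠ ∞)
    (hnorm : eLpNorm a (ENNReal.ofReal r) (wMeasure w) ≤ m ^ (1 / r - 1 / p)) :
    ∫⁻ x, ‖a x‖ₑ ^ r ∂(wMeasure w) < ∞ := by
  have h := hnorm.trans_lt
    (by simp [lt_top_iff_ne_top, ENNReal.rpow_eq_top_iff, hm, hm'] : m ^ (1 / r - 1 / p) < ∞)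
  simpa [ENNReal.toReal_ofReal hr.le] using
    lintegral_rpow_enorm_lt_top_of_eLpNorm_lt_top (by simpa using hr) ENNReal.ofReal_ne_top h

theorem AvgBound.exists_atom_le (hn : 1 ≤ n) (hA : AvgBound r A w) (hw : IsWeight w) (hAt : A < ∞)
    {p : ℝ} (hp : 0 < p) (hpr : p < r) {q : ℝ≥0∞} (hrq : ENNReal.ofReal r ≤ q) {N d s : ℕ}
    (hd : d ≤ N) (hds : d ≤ s) (hrd : n * r < p * (n + d + 1)) :
    ∃ C : ℝ≥0∞, C < ∞ ∧ ∀ a : E n → ℂ, IsAtom w p q s a →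
      LocallyIntegrable a ∧ ∫⁻ x, maxFn N a x ^ p ∂(wMeasure w) ≤ C := by
  have hr : 0 < r := hp.trans hpr
  obtain ⟨D₁, hD₁, hgrow⟩ := hA.exists_growth hr hAt
  obtain ⟨D₂, hD₂, hnbd⟩ := hA.exists_neighbourhood hr hAt
  set D₃ := D₁ * ENNReal.ofReal (2 ^ (n * r)) with hD₃
  have hD₃t : D₃ < ∞ := ENNReal.mul_lt_top hD₁ ENNReal.ofReal_lt_top
  obtain ⟨C₁, hC₁, hloc⟩ := hA.exists_lintegral_maxFn_le hw hAt hp hpr N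
    (ENNReal.add_lt_top.2 ⟨hD₂, hD₃t⟩)
  obtain ⟨C₂, hC₂, hfar⟩ := hA.exists_lintegral_compl_le hw hAt hr hp hd hrd
  refine ⟨C₁ + C₂, ENNReal.add_lt_top.2 ⟨hC₁, hC₂⟩, ?_⟩
  rintro a ⟨ha, x₀, l, hl, hsupp, hnorm, hmom⟩
  have hm := (wMeasure_cube_pos hw x₀ hl).ne'
  have hm' := (wMeasure_cube_lt_top hw x₀ l).ne
  have hnorm' := eLpNorm_le_of_support hr hrq ha (measurableSet_cube x₀ l) hsupp hm hm' hnorm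
  refine ⟨hA.locallyIntegrable hw hr hAt ha (lintegral_rpow_ne_top_of_eLpNorm hr hm hm' hnorm'), ?_⟩
  -- For `n ≥ 1`, side below `1` means volume below `1`, where the moment conditions are available.
  rcases lt_or_ge l 1 with hl1 | hl1
  · rw [← lintegral_add_compl _ (measurableSet_cube x₀ (2 * l))]
    refine add_le_add (hloc a _ _ ha hm hm' hnorm' ?_) (hfar a x₀ l hl hl1 ha hsupp hnorm'
      fun α hα => hmom (volume_cube_lt_one hn x₀ hl1) α (hα.trans hds))
    refine (hgrow x₀ l (2 * l) hl (by linarith) (by linarith)).trans ?_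
    rw [mul_div_assoc, div_self hl.ne', mul_one]
    gcongr
    exact le_add_self
  · rw [← setLIntegral_eq_of_support_subset (s := cube x₀ (l + 2)) fun x hx => ?_]
    · exact (hloc a _ _ ha hm hm' hnorm'
        ((hnbd x₀ l hl1).trans (by gcongr; exact le_self_add))).trans le_self_add
    · by_contra h
      exact hx (by simp only [maxFn_eq_zero hsupp h, ENNReal.zero_rpow_of_pos hp])

theorem AvgBound.exists_singleAtom_le (hA : AvgBound r A w) (hw : IsWeight w)
    (hAt : A < ∞) {p : ℝ} (hp : 0 < p) (hp1 : p ≤ 1) (hr1 : 1 < r) {q : ℝ≥0∞}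
    (hrq : ENNReal.ofReal r ≤ q) (N : ℕ) :
    ∃ C : ℝ≥0∞, C < ∞ ∧ ∀ a : E n → ℂ, IsSingleAtom w p q a →
      LocallyIntegrable a ∧ ∫⁻ x, maxFn N a x ^ p ∂(wMeasure w) ≤ C := by
  have hpr : p < r := hp1.trans_lt hr1
  have hr : 0 < r := hp.trans hpr
  obtain ⟨C, hC, hloc⟩ := hA.exists_lintegral_maxFn_le hw hAt hp hpr N ENNReal.one_lt_top
  refine ⟨C, hC, ?_⟩
  rintro a ⟨ha, hnorm⟩
  have hm : wMeasure w Set.univ ≠ 0 :=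
    ((wMeasure_cube_pos hw 0 one_pos).trans_le (measure_mono (Set.subset_univ _))).ne'
  by_cases hm' : wMeasure w Set.univ = ∞
  -- The exponent `1/q - 1/p` is negative, so the norm bound is `0` and `a` vanishes almost
  -- everywhere, also for Lebesgue measure since `w > 0` almost everywhere.
  · have hq1 : 1 < q := lt_of_lt_of_le (by simpa using hr1) hrq
    have hneg : q⁻¹.toReal - 1 / p < 0 := by
      have h1 : q⁻¹.toReal < 1 := by
        have := (ENNReal.toReal_lt_toReal (by simp [(zero_lt_one.trans hq1).ne'])
          ENNReal.one_ne_top).2 (ENNReal.inv_lt_one.2 hq1)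
        simpa using this
      have h2 : 1 ≤ 1 / p := (one_le_div hp).2 hp1
      linarith
    rw [hm', ENNReal.top_rpow_of_neg hneg, nonpos_iff_eq_zero, eLpNorm_eq_zero_iff
      (ha.mono_ac (wMeasure_absolutelyContinuous w)) (zero_lt_one.trans hq1).ne'] at hnorm
    have ha0 : a =ᵐ[volume] 0 := by
      filter_upwards [(ae_withDensity_iff' hw.aemeasurable).1 hnorm, hw.pos_ae] with x hx hpos
      exact hx (by simpa using hpos)
    refine ⟨(locallyIntegrable_const (0 : ℂ)).congr ha0.symm, ?_⟩
    have : ∀ x, maxFn N a x = 0 := fun x => by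
      rw [maxFn_congr ha0]
      exact le_antisymm (maxFn_le fun t ht _ φ _ => by simp) zero_le
    simp [this, ENNReal.zero_rpow_of_pos hp]
  · have hnorm' := eLpNorm_le_of_support hr hrq ha MeasurableSet.univ
      (ae_of_all _ fun x hx => absurd (Set.mem_univ x) hx) hm hm' hnorm
    refine ⟨hA.locallyIntegrable hw hr hAt ha
      (lintegral_rpow_ne_top_of_eLpNorm hr hm hm' hnorm'), ?_⟩
    have := hloc a Set.univ _ ha hm hm' hnorm' (by rw [one_mul])
    rwa [Measure.restrict_univ] at this

end Atoms

/-! ### Grand maximal functions of distributions -/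

section Distributions

variable {n : ℕ}

/-- The translates of a test function depend continuously on the translation. -/
theorem continuous_dilate (φ : Test n) {t : ℝ} (ht : 0 < t) :
    Continuous fun x => dilate φ t ht x := by
  refine continuous_iff_continuousAt.2 fun x₀ => ?_
  obtain ⟨R, hR⟩ := φ.hasCompactSupport.isBounded.subset_closedBall (0 : E n)
  let K : TopologicalSpace.Compacts (E n) :=
    ⟨Metric.closedBall x₀ (1 + t * R), isCompact_closedBall _ _⟩
  -- Nearby translates share one compact support, so continuity reduces to uniform convergence of
  -- every derivative, which follows from its uniform continuity.
  have hsupp : ∀ x ∈ Metric.ball x₀ 1, Function.support (dilate φ t ht x) ⊆ K := by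
    intro x hx y hy
    have hy' : t⁻¹ • (x - y) ∈ tsupport φ := by
      refine subset_closure fun h => hy ?_
      rw [dilate_apply, h, smul_zero]
    have h1 := hR hy'
    rw [mem_closedBall_zero_iff, norm_smul, norm_inv, Real.norm_of_nonneg ht.le,
      inv_mul_le_iff₀ ht] at h1
    change y ∈ Metric.closedBall x₀ (1 + t * R)
    rw [Metric.mem_ball] at hx
    rw [Metric.mem_closedBall]
    have := dist_triangle y x x₀
    rw [dist_eq_norm y x, norm_sub_rev] at this
    linarith
  let ψ : Metric.ball x₀ 1 → ContDiffMapSupportedIn (E n) ℂ ⊤ K := fun x =>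
    .of_support_subset (dilate φ t ht x).contDiff (hsupp x x.2)
  have hψ : Continuous ψ := by
    rw [ContDiffMapSupportedIn.continuous_iff_comp]
    intro i
    set G := iteratedFDeriv ℝ i (dilate φ t ht 0 : E n → ℂ) with hG
    have hGc : Continuous G := (dilate φ t ht 0).contDiff.continuous_iteratedFDeriv
      (by exact_mod_cast le_top)
    have hGu : UniformContinuous G :=
      ((dilate φ t ht 0).hasCompactSupport.iteratedFDeriv i).uniformContinuous_of_continuous hGc
    have happ : ∀ (x : Metric.ball x₀ 1) (y : E n),
        (ContDiffMapSupportedIn.structureMapCLM ℝ ⊤ i (ψ x)) y = G (y - x) := fun x y => by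
      rw [ContDiffMapSupportedIn.structureMapCLM_top_apply, hG, ← iteratedFDeriv_comp_sub]
      congr 1
      ext y
      change dilate φ t ht x y = dilate φ t ht 0 (y - x)
      rw [dilate_apply, dilate_apply, zero_sub, neg_sub]
    rw [Metric.continuous_iff]
    intro x ε hε
    obtain ⟨δ, hδ, H⟩ := Metric.uniformContinuous_iff.1 hGu (ε / 2) (by positivity)
    refine ⟨δ, hδ, fun x' hx' => ?_⟩
    refine lt_of_le_of_lt ((BoundedContinuousFunction.dist_le (by positivity)).2 fun y => ?_)
      (half_lt_self hε)
    simp only [Function.comp_apply, happ]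
    refine (H ?_).le
    rw [dist_sub_left]
    exact hx'
  have hcomp : Continuous fun x : Metric.ball x₀ 1 => dilate φ t ht x :=
    (TestFunction.continuous_ofSupportedIn (Ω := ⊤) (K := K) (fun _ _ => trivial)).comp hψ
  exact (continuousOn_iff_continuous_domRestrict.2 hcomp).continuousAt
    (Metric.ball_mem_nhds x₀ one_pos)

theorem measurable_grandMax (N : ℕ) (f : Dist n) : Measurable (grandMax N f) := by
  refine LowerSemicontinuous.measurable ?_
  unfold grandMax
  exact lowerSemicontinuous_iSup fun t => lowerSemicontinuous_iSup fun ht =>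
    lowerSemicontinuous_iSup fun _ => lowerSemicontinuous_iSup fun φ =>
    lowerSemicontinuous_iSup fun _ =>
    (f.continuous.comp (continuous_dilate φ ht)).enorm.lowerSemicontinuous

theorem testClass_anti {N M : ℕ} (h : N ≤ M) : testClass (n := n) M ⊆ testClass N :=
  fun _ hφ => ⟨hφ.1, hφ.2.1, fun k hk => hφ.2.2 k (by omega)⟩

theorem grandMax_anti {N M : ℕ} (h : N ≤ M) (f : Dist n) (x : E n) :
    grandMax M f x ≤ grandMax N f x :=
  iSup_mono fun _ => iSup_mono fun _ => iSup_mono fun _ =>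
    biSup_mono fun _ hφ => testClass_anti h hφ

theorem hardyNorm_anti {p : ℝ} (hp : 0 < p) (w : E n → ℝ) {N M : ℕ} (h : N ≤ M) (f : Dist n) :
    hardyNorm p w M f ≤ hardyNorm p w N f :=
  ENNReal.rpow_le_rpow (lintegral_mono fun x => ENNReal.rpow_le_rpow (grandMax_anti h f x) hp.le)
    (by positivity)

theorem hardySpace_mono {p : ℝ} (hp : 0 < p) (w : E n → ℝ) {N M : ℕ} (h : N ≤ M) :
    hardySpace p w N ⊆ hardySpace p w M := fun f hf =>
  ⟨(measurable_grandMax M f).aemeasurable, (hardyNorm_anti hp w h f).trans_lt hf.2⟩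

end Distributions

/-! ### Subadditivity of the power `p ≤ 1` -/

theorem rpow_sum_le_sum_rpow_of_le_one {ι : Type*} {p : ℝ} (hp : 0 < p) (hp1 : p ≤ 1)
    (s : Finset ι) (u : ι → ℝ≥0∞) : (∑ i ∈ s, u i) ^ p ≤ ∑ i ∈ s, u i ^ p := by
  classical
  induction s using Finset.induction_on with
  | empty => simp [hp]
  | insert i s hi ih =>
    rw [Finset.sum_insert hi, Finset.sum_insert hi]
    exact (ENNReal.rpow_add_le_add_rpow _ _ hp.le hp1).trans (by gcongr)

theorem rpow_tsum_le_tsum_rpow_of_le_one {ι : Type*} {p : ℝ} (hp : 0 < p) (hp1 : p ≤ 1)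
    (u : ι → ℝ≥0∞) : (∑' i, u i) ^ p ≤ ∑' i, u i ^ p := by
  have h : Tendsto (fun s : Finset ι => (∑ i ∈ s, u i) ^ p) atTop (𝓝 ((∑' i, u i) ^ p)) :=
    (ENNReal.continuous_rpow_const.tendsto _).comp ENNReal.summable.hasSum
  exact le_of_tendsto h (Eventually.of_forall fun s =>
    (rpow_sum_le_sum_rpow_of_le_one hp hp1 s u).trans (ENNReal.sum_le_tsum s))

/-! ### Summation over an atomic decomposition -/

section AtomicDecomposition

variable {n : ℕ} {w : E n → ℝ} {p : ℝ} {q : ℝ≥0∞} {s : ℕ}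

/-- Convergence in the sense of distributions, tested on each dilate, suffices for this pointwise
bound. -/
theorem grandMax_le_tsum {f : Dist n} {c : ℕ → ℂ} {a : ℕ → E n → ℂ}
    (h : IsAtomicDecomp w p q s f c a) (N : ℕ) (x : E n) :
    grandMax N f x ≤ ∑' i, ‖c i‖ₑ * maxFn N (a i) x := by
  refine iSup_le fun t => iSup_le fun ht => iSup_le fun ht1 => iSup₂_le fun φ hφ => ?_
  refine le_of_tendsto (h.tendsto (dilate φ t ht x)).enorm (Eventually.of_forall fun k => ?_)
  refine (enorm_sum_le _ _).trans (le_trans ?_ (ENNReal.sum_le_tsum (Finset.range k)))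
  refine Finset.sum_le_sum fun i _ => ?_
  rw [enorm_mul]
  gcongr
  exact le_maxFn (a i) x ht ht1 hφ

theorem hardyNorm_le_of_atoms (hp : 0 < p) (hp1 : p ≤ 1) {N : ℕ} {C : ℝ≥0∞}
    (hsingle : ∀ a : E n → ℂ, IsSingleAtom w p q a →
      LocallyIntegrable a ∧ ∫⁻ x, maxFn N a x ^ p ∂(wMeasure w) ≤ C)
    (hatom : ∀ a : E n → ℂ, IsAtom w p q s a →
      LocallyIntegrable a ∧ ∫⁻ x, maxFn N a x ^ p ∂(wMeasure w) ≤ C)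
    {f : Dist n} {c : ℕ → ℂ} {a : ℕ → E n → ℂ} (h : IsAtomicDecomp w p q s f c a) :
    hardyNorm p w N f ≤ C ^ (1 / p) * (∑' i, ‖c i‖ₑ ^ p) ^ (1 / p) := by
  have hall : ∀ i, LocallyIntegrable (a i) ∧ ∫⁻ x, maxFn N (a i) x ^ p ∂(wMeasure w) ≤ C := by
    intro i
    rcases Nat.eq_zero_or_pos i with rfl | hi
    · exact hsingle _ h.single
    · exact hatom _ (h.atom i hi)
  rw [hardyNorm, ← ENNReal.mul_rpow_of_nonneg _ _ (by positivity)]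
  refine ENNReal.rpow_le_rpow ?_ (by positivity)
  calc ∫⁻ x, grandMax N f x ^ p ∂(wMeasure w)
      ≤ ∫⁻ x, ∑' i, ‖c i‖ₑ ^ p * maxFn N (a i) x ^ p ∂(wMeasure w) := by
        refine lintegral_mono fun x => ?_
        refine (ENNReal.rpow_le_rpow (grandMax_le_tsum h N x) hp.le).trans
          ((rpow_tsum_le_tsum_rpow_of_le_one hp hp1 _).trans (le_of_eq ?_))
        simp_rw [ENNReal.mul_rpow_of_nonneg _ _ hp.le]
    _ = ∑' i, ‖c i‖ₑ ^ p * ∫⁻ x, maxFn N (a i) x ^ p ∂(wMeasure w) := by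
        have hmeas : ∀ i, Measurable fun x => maxFn N (a i) x ^ p := fun i =>
          (measurable_maxFn N (hall i).1).pow_const p
        rw [lintegral_tsum fun i => ((hmeas i).const_mul _).aemeasurable]
        simp_rw [lintegral_const_mul _ (hmeas _)]
    _ ≤ ∑' i, ‖c i‖ₑ ^ p * C := ENNReal.tsum_le_tsum fun i => by
        gcongr
        exact (hall i).2
    _ = _ := by rw [ENNReal.tsum_mul_right, mul_comm]

theorem tsum_enorm_rpow_lt_top (hp : 0 < p) {c : ℕ → ℂ} (h : Summable fun i => ‖c i‖ ^ p) :
    ∑' i, ‖c i‖ₑ ^ p < ∞ := by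
  have : ∀ i, ‖c i‖ₑ ^ p = ENNReal.ofReal (‖c i‖ ^ p) := fun i => by
    rw [← ofReal_norm, ENNReal.ofReal_rpow_of_nonneg (norm_nonneg _) hp.le]
  simp_rw [this]
  exact h.tsum_ofReal_lt_top

/-- There is an exponent above the critical index, at most `q`, for which the decay of the maximal
function of an atom beats the growth of the weight. -/
theorem exists_exponent (hn : 1 ≤ n) (hadm : Admissible w p q s) :
    ∃ r : ℝ, critIndex w < r ∧ ENNReal.ofReal r ≤ q ∧
      n * r < p * (n + ⌊(n : ℝ) * (critIndex w / p - 1)⌋.toNat + 1) := by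
  have hp := hadm.p_pos
  have hn' : (0 : ℝ) < n := by exact_mod_cast hn
  set κ := critIndex w with hκ
  set d := ⌊(n : ℝ) * (κ / p - 1)⌋.toNat with hd
  -- The strict bound `n (κ/p - 1) < d + 1` given by the floor leaves room for an exponent above
  -- `κ`.
  have h1 : n * κ < p * (n + d + 1) := by
    have h2 : (n : ℝ) * (κ / p - 1) < d + 1 := by
      refine (Int.lt_floor_add_one _).trans_le ?_
      gcongr
      exact_mod_cast Int.self_le_toNat _
    have h3 := mul_lt_mul_of_pos_left h2 hp
    have h4 : p * (n * (κ / p - 1)) = n * κ - p * n := by field_simp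
    linarith
  obtain ⟨r₁, -, hr₁, hr₁q⟩ := ENNReal.lt_iff_exists_real_btwn.1 hadm.crit_lt
  have hr₁' : κ < r₁ := (ENNReal.ofReal_lt_ofReal_iff').1 hr₁ |>.1
  have hb : κ < p * (n + d + 1) / n := by rw [lt_div_iff₀ hn']; linarith
  obtain ⟨r₂, hr₂, hr₂'⟩ := exists_between hb
  rw [lt_div_iff₀ hn'] at hr₂'
  refine ⟨min r₁ r₂, lt_min hr₁' hr₂,
    (ENNReal.ofReal_le_ofReal (min_le_left _ _)).trans hr₁q.le, ?_⟩
  have : n * min r₁ r₂ ≤ n * r₂ := by gcongr; exact min_le_right _ _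
  linarith

theorem exists_hardyNorm_le_atomic (hn : 1 ≤ n) (hw : AInftyLoc w) (hadm : Admissible w p q s) :
    ∃ C : ℝ≥0∞, C < ∞ ∧ ∀ (f : Dist n) (c : ℕ → ℂ) (a : ℕ → E n → ℂ),
      IsAtomicDecomp w p q s f c a →
        hardyNorm p w (Npw p w) f ≤ C * (∑' i, ‖c i‖ₑ ^ p) ^ (1 / p) := by
  have hp := hadm.p_pos
  obtain ⟨r, hcr, hrq, hrd⟩ := exists_exponent hn hadm
  obtain ⟨A, hAt, hA⟩ := exists_avgBound hw hcr
  have hW : IsWeight w := by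
    obtain ⟨_, _, h, _⟩ := hw
    exact h
  have hr1 : 1 < r := (one_le_critIndex hw).trans_lt hcr
  have hds : ⌊(n : ℝ) * (critIndex w / p - 1)⌋.toNat ≤ s := Int.toNat_le.2 hadm.floor_le
  have hdN : ⌊(n : ℝ) * (critIndex w / p - 1)⌋.toNat ≤ Npw p w := by
    unfold Npw
    omega
  obtain ⟨C₁, hC₁, h₁⟩ := hA.exists_singleAtom_le hW hAt hp hadm.p_le_one hr1 hrq (Npw p w)
  obtain ⟨C₂, hC₂, h₂⟩ := hA.exists_atom_le hn hW hAt hp (hadm.p_le_one.trans_lt hr1) hrq hdN hds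
    hrd
  refine ⟨(C₁ + C₂) ^ (1 / p), ENNReal.rpow_lt_top_of_nonneg (by positivity)
    (ENNReal.add_lt_top.2 ⟨hC₁, hC₂⟩).ne, fun f c a h => ?_⟩
  exact hardyNorm_le_of_atoms hp hadm.p_le_one
    (fun a ha => ⟨(h₁ a ha).1, (h₁ a ha).2.trans le_self_add⟩)
    (fun a ha => ⟨(h₂ a ha).1, (h₂ a ha).2.trans le_add_self⟩) h

end AtomicDecomposition

end LocalHardy

/-! ### The theorem -/

theorem theorem3p1 {n : ℕ} (hn : 1 ≤ n) (w : LocalHardy.E n → ℝ) (hw : LocalHardy.AInftyLoc w)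
    (p : ℝ) (q : ℝ≥0∞) (s : ℕ) (hadm : LocalHardy.Admissible w p q s)
    (N : ℕ) (hN : LocalHardy.Npw p w ≤ N) :
    LocalHardy.atomicSpace w p q s ⊆ LocalHardy.hardySpace p w (LocalHardy.Npw p w) ∧
    LocalHardy.hardySpace p w (LocalHardy.Npw p w) ⊆ LocalHardy.hardySpace p w N ∧
    ∃ C : NNReal, 0 < C ∧ ∀ f ∈ LocalHardy.atomicSpace w p q s,
      LocalHardy.hardyNorm p w N f ≤ LocalHardy.hardyNorm p w (LocalHardy.Npw p w) f ∧
      LocalHardy.hardyNorm p w (LocalHardy.Npw p w) f ≤ C * LocalHardy.atomicNorm w p q s f := by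
  have hp := hadm.p_pos
  obtain ⟨C, hC, h⟩ := LocalHardy.exists_hardyNorm_le_atomic hn hw hadm
  refine ⟨?_, LocalHardy.hardySpace_mono hp w hN, C.toNNReal + 1, by positivity,
    fun f _ => ⟨LocalHardy.hardyNorm_anti hp w hN f, ?_⟩⟩
  · rintro f ⟨c, a, hca⟩
    refine ⟨(LocalHardy.measurable_grandMax _ f).aemeasurable, (h f c a hca).trans_lt ?_⟩
    exact ENNReal.mul_lt_top hC (ENNReal.rpow_lt_top_of_nonneg (by positivity)
      (LocalHardy.tsum_enorm_rpow_lt_top hp hca.summable).ne)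
  · have hC' : ((C.toNNReal + 1 : NNReal) : ℝ≥0∞) = C + 1 := by
      rw [ENNReal.coe_add, ENNReal.coe_toNNReal hC.ne, ENNReal.coe_one]
    have h0 : C + 1 ≠ 0 := by positivity
    have ht : C + 1 ≠ ∞ := ENNReal.add_ne_top.2 ⟨hC.ne, ENNReal.one_ne_top⟩
    -- Dividing by `C + 1`, finite and nonzero, reduces the bound by the infimum to a bound for each
    -- decomposition.
    rw [hC', mul_comm, ← ENNReal.div_le_iff h0 ht]
    refine le_iInf fun c => le_iInf fun a => le_iInf fun hca => ?_
    rw [ENNReal.div_le_iff h0 ht, mul_comm]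
    exact (h f c a hca).trans (by gcongr; exact le_self_add)
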